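/- Let $p\ge 29$ be a prime, and for $n\in\mathbb N$ put $f(n)=18+2\log_2 n$ if $n<2^{96}$ and $f(n)=435+10\log_2 n$ if $n\ge 2^{96}$. Let $T$ be one of the twenty types below and let $k\ge 1$ be an integer subject to the indicated restriction (types VI, VII, XV, XVI do not involve $k$). Suppose that the integer $\beta$ attached to $T$ is a perfect square, and let $\alpha$ be its square root, normalised by $\alpha\equiv 1\pmod 4$ if $\beta$ is odd and $\alpha\ge 0$ if $\beta$ is even. A pair of Ivorra curves of type $T$ is the $2$-isogenous pair of elliptic curves over $\mathbb Q$ $$E\colon y^2=x^3+ax^2+bx,\qquad E'\colon y^2=x^3-2ax^2+(a^2-4b)x,$$ where: - I: $\beta=p-2^k$, $a=\pm\alpha$, $b=-2^{k-2}$, $2\le k\le 5$; - II: $\beta=p+2^k$, $a=\pm\alpha$, $b=2^{k-2}$, $k\in\{3,5\}$; - III: $\beta=p-2^k$, $a=-\alpha$, $b=-2^{k-2}$, $4\le k\le f(p)$; - IV: $\beta=p+2^k$, $a=-\alpha$, $b=2^{k-2}$, $4\le k\le f(p)$; - V: $\beta=2^k-p$, $a=-\alpha$, $b=2^{k-2}$,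 $4\le k\le f(p)$; - VI: $\beta=p-1$, $a=\pm2\alpha$, $b=-1$; - VII: $\beta=p-1$, $a=\pm2\alpha$, $b=p$; - VIII: $\beta=p-2^k$, $a=\pm2\alpha$, $b=-2^k$, $2\le k\le f(p)$; - IX: $\beta=p+2^k$, $a=\pm2\alpha$, $b=2^k$, $2\le k\le f(p)$; - X: $\beta=2^k-p$, $a=\pm2\alpha$, $b=2^k$, $2\le k\le f(p)$; - XI: $\beta=2p^k-1$, $a=\pm2\alpha$, $b=-1$, $k\in\{1,2\}$; - XII: $\beta=2p^k-1$, $a=\pm2\alpha$, $b=2p^k$, $k\in\{1,2\}$; - XIII: $\beta=p^k+2$, $a=\pm2\alpha$, $b=p^k$, $1\le k\le 164969$; - XIV: $\beta=p^k+2$, $a=\pm2\alpha$, $b=2$, $1\le k\le 164969$; - XV: $\beta=p-2$, $a=\pm2\alpha$, $b=p$; - XVI: $\beta=p-2$, $a=\pm2\alpha$, $b=-2$; - XVII: $\beta=(p^k-1)/2$, $a=\pm4\alpha$, $b=-2$, $k\in\{1,2\}$; - XVIII: $\beta=(p^k-1)/2$, $a=\pm4\alpha$, $b=2p^k$, $k\in\{1,2\}$;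 - XIX: $\beta=(p^k+1)/2$, $a=\pm4\alpha$, $b=2$, $k\in\{1,2\}$; - XX: $\beta=(p^k+1)/2$, $a=\pm4\alpha$, $b=2p^k$, $k\in\{1,2\}$. Let $E,E'$ be a pair of Ivorra curves of type $T$. Then $\operatorname{rank}_{\mathbb Z}E(\mathbb Q)=\operatorname{rank}_{\mathbb Z}E'(\mathbb Q)$, and this common rank $r$ satisfies $r\le 1$ in each of the following cases: 1. $T\in\{\mathrm{I,II,III,IV,V,VI,VII,XI,XIII,XV}\}$; 2. $T=\mathrm{VIII}$ and $k=2$; 3. $T=\mathrm{X}$; 4. $T=\mathrm{XII}$, $k=2$, and $-64$ is not a fourth power modulo $p$; 5. $T=\mathrm{XVI}$; 6. $T=\mathrm{XVII}$, $k=1$ and $p\equiv 3\pmod 8$; 7. $T=\mathrm{XVIII}$ and $k=1$; 8. $T=\mathrm{XIX}$ and $p\not\equiv 1\pmod 8$. Moreover, in case 6 the rank is always $0$. -/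

import Mathlib

/-- The labels of the twenty families of Ivorra curves. -/
inductive IvorraType : Type
  | I | II | III | IV | V | VI | VII | VIII | IX | X
  | XI | XII | XIII | XIV | XV | XVI | XVII | XVIII | XIX | XX

namespace IvorraType

/-- The upper bound `f(n)` for the exponent `k` in several families. -/
noncomputable def expBound (n : ℕ) : ℝ :=
  if n < 2 ^ 96 then 18 + 2 * Real.logb 2 n else 435 + 10 * Real.logb 2 n

/-- The integer `β` which has to be a perfect square. The two divisions by `2` are exact,
since `p` is an odd prime wherever `beta` is used. -/
def beta (p k : ℕ) : IvorraType → ℤ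
  | I => p - 2 ^ k
  | II => p + 2 ^ k
  | III => p - 2 ^ k
  | IV => p + 2 ^ k
  | V => 2 ^ k - p
  | VI => p - 1
  | VII => p - 1
  | VIII => p - 2 ^ k
  | IX => p + 2 ^ k
  | X => 2 ^ k - p
  | XI => 2 * p ^ k - 1
  | XII => 2 * p ^ k - 1
  | XIII => p ^ k + 2
  | XIV => p ^ k + 2
  | XV => p - 2
  | XVI => p - 2
  | XVII => (p ^ k - 1) / 2
  | XVIII => (p ^ k - 1) / 2
  | XIX => (p ^ k + 1) / 2
  | XX => (p ^ k + 1) / 2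

/-- The coefficient `a` belongs to the family, given the chosen square root `α` of `β`. -/
def AdmissibleA (α a : ℤ) : IvorraType → Prop
  | I | II => a = α ∨ a = -α
  | III | IV | V => a = -α
  | VI | VII | VIII | IX | X | XI | XII | XIII | XIV | XV | XVI => a = 2 * α ∨ a = -(2 * α)
  | XVII | XVIII | XIX | XX => a = 4 * α ∨ a = -(4 * α)

/-- The coefficient `b`. (In the families with `2 ^ (k - 2)` one always has `2 ≤ k`.) -/
def coeffB (p k : ℕ) : IvorraType → ℤ
  | I => -2 ^ (k - 2)
  | II => 2 ^ (k - 2)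
  | III => -2 ^ (k - 2)
  | IV => 2 ^ (k - 2)
  | V => 2 ^ (k - 2)
  | VI => -1
  | VII => p
  | VIII => -2 ^ k
  | IX => 2 ^ k
  | X => 2 ^ k
  | XI => -1
  | XII => 2 * p ^ k
  | XIII => p ^ k
  | XIV => 2
  | XV => p
  | XVI => -2
  | XVII => -2
  | XVIII => 2 * p ^ k
  | XIX => 2
  | XX => 2 * p ^ k

/-- The admissible exponents `k`. Families VI, VII, XV and XVI do not involve `k`. -/
def AdmissibleK (p k : ℕ) : IvorraType → Prop
  | I => 2 ≤ k ∧ k ≤ 5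
  | II => k = 3 ∨ k = 5
  | III | IV | V => 4 ≤ k ∧ (k : ℝ) ≤ expBound p
  | VIII | IX | X => 2 ≤ k ∧ (k : ℝ) ≤ expBound p
  | XIII | XIV => 1 ≤ k ∧ k ≤ 164969
  | XI | XII | XVII | XVIII | XIX | XX => k = 1 ∨ k = 2
  | VI | VII | XV | XVI => True

end IvorraType

/-- `α` is the square root of `β` normalised by `α ≡ 1 (mod 4)` if `β` is odd and by `0 ≤ α` if
`β` is even. -/
def IsNormalizedSqrt (α β : ℤ) : Prop :=
  α ^ 2 = β ∧ (Odd β → α ≡ 1 [ZMOD 4]) ∧ (Even β → 0 ≤ α)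

/-- `a`, `b` are the coefficients of a pair of Ivorra curves of type `T` with parameters `p`, `k`. -/
structure IsIvorraPair (T : IvorraType) (p k : ℕ) (a b : ℤ) : Prop where
  prime : p.Prime
  le_p : 29 ≤ p
  admissibleK : T.AdmissibleK p k
  admissibleA : ∃ α : ℤ, IsNormalizedSqrt α (T.beta p k) ∧ T.AdmissibleA α a
  coeffB_eq : b = T.coeffB p k

/-- The curve `y² = x³ + a x² + b x` over `ℚ`. -/
def ivorraCurve (a b : ℤ) : WeierstrassCurve ℚ :=
  { a₁ := 0, a₂ := a, a₃ := 0, a₄ := b, a₆ := 0 }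

/-- The 2-isogenous curve `y² = x³ - 2 a x² + (a² - 4 b) x` over `ℚ`. -/
def ivorraCurve' (a b : ℤ) : WeierstrassCurve ℚ :=
  ivorraCurve (-2 * a) (a ^ 2 - 4 * b)

/-- The Mordell–Weil rank: the rank of the abelian group of rational points, as a cardinal (so no
default value intervenes). -/
noncomputable def mordellWeilRank (W : WeierstrassCurve ℚ) : Cardinal :=
  Module.rank ℤ W.toAffine.Point

/-! The proof is descent via a 2-isogeny. Let φ : E → E' have kernel {0, (0,0)}, let φ' be the dual
isogeny, and put b' = a² - 4b. Both composites are multiplication by 2, so both kernels are torsion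
and the ranks agree (`rank_eq`).

For the upper bound, the abscissa modulo squares, with (0,0) sent to the class of b, is a
homomorphism on E(ℚ) whose kernel lies in φ'(E'(ℚ)); the same holds on E' with φ. In the families
concerned b and b' have no prime divisors other than 2 and p, so a class amounts to three parities:
the sign and the valuations at 2 and p (`parity`, `descentHom`). If the two images have at most n
and n' elements, then [E : φ'E'] [E' : φE] ≤ n n'. When b' is not a square, (0,0) on E' lies in ker
φ' but not in φ(E), whence 2 [E : 2E] ≤ n n'. Heights show that E(ℚ) is finitely generated, and its
point of order two then gives 2^(r+1) ≤ [E : 2E]. Altogether 2^(r+2) ≤ n n'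
(`rank_le_of_descentBound`): n n' ≤ 8 gives r ≤ 1, and n n' ≤ 4 gives r = 0.

To bound n, note that the coordinate at l = 2 or p vanishes if l does not divide b, and the sign
vanishes if x² + ax + b > 0 for all x < 0. This suffices for case 1. For VIII, X, XVI, XVII, XVIII
and XIX one also excludes a class d on E, on E', or on each, by showing through congruences modulo
powers of 2 or p that its covering d N² = d² M⁴ + a d M² e² + b e⁴ has no coprime solution; this
halves the bound. Case 4 is vacuous, since -64 is always a fourth power there. -/

open WeierstrassCurve.Affine

/-- The Weierstrass curve `y² = x³ + a x² + b x` over `ℚ`. -/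
def twoTorsionCurve (a b : ℚ) : WeierstrassCurve ℚ :=
  { a₁ := 0, a₂ := a, a₃ := 0, a₄ := b, a₆ := 0 }

/-! ### The group law through collinear triples. -/

namespace TwoTorsionCurve

variable {a b : ℚ}

/-- The group of rational points of `y² = x³ + a x² + b x`. -/
abbrev Pt (a b : ℚ) : Type := (twoTorsionCurve a b).toAffine.Point

lemma negY_eq (x y : ℚ) : (twoTorsionCurve a b).toAffine.negY x y = -y := by
  simp [WeierstrassCurve.Affine.negY, twoTorsionCurve]

lemma equation_iff_eq (x y : ℚ) :
    (twoTorsionCurve a b).toAffine.Equation x y ↔ y ^ 2 = x ^ 3 + a * x ^ 2 + b * x := by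
  simp [WeierstrassCurve.Affine.equation_iff, twoTorsionCurve]

lemma nonsingular_iff_eq (x y : ℚ) :
    (twoTorsionCurve a b).toAffine.Nonsingular x y ↔ y ^ 2 = x ^ 3 + a * x ^ 2 + b * x ∧
      (3 * x ^ 2 + 2 * a * x + b ≠ 0 ∨ y ≠ 0) := by
  rw [WeierstrassCurve.Affine.nonsingular_iff, equation_iff_eq]
  simp only [twoTorsionCurve]
  refine and_congr_right fun _ ↦ or_congr ?_ ?_
  · constructor <;> intro h h' <;> apply h <;> linarith
  · constructor <;> intro h h' <;> apply h <;> linarith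

lemma nonsingular_of_eq (hb : b ≠ 0) (hd : a ^ 2 - 4 * b ≠ 0) {x y : ℚ}
    (h : y ^ 2 = x ^ 3 + a * x ^ 2 + b * x) :
    (twoTorsionCurve a b).toAffine.Nonsingular x y := by
  refine (nonsingular_iff_eq x y).mpr ⟨h, ?_⟩
  by_contra! H
  obtain ⟨h1, rfl⟩ := H
  have h2 : x * (x ^ 2 + a * x + b) = 0 := by linear_combination -h
  rcases mul_eq_zero.mp h2 with rfl | h2
  · exact hb (by linear_combination h1)
  · have h3 : x * (2 * x + a) = 0 := by linear_combination h1 - h2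
    rcases mul_eq_zero.mp h3 with rfl | h3
    · exact hb (by linear_combination h1)
    · exact hd (by linear_combination (2 * x + a) * h3 - 4 * h2)

lemma some_congr {x y x' y' : ℚ} {h : (twoTorsionCurve a b).toAffine.Nonsingular x y}
    {h' : (twoTorsionCurve a b).toAffine.Nonsingular x' y'} (hx : x = x') (hy : y = y') :
    (Point.some x y h : Pt a b) = Point.some x' y' h' := by
  subst hx hy; rfl

lemma nonsingular_neg' {x y : ℚ} (h : (twoTorsionCurve a b).toAffine.Nonsingular x y) :
    (twoTorsionCurve a b).toAffine.Nonsingular x (-y) := by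
  rw [nonsingular_iff_eq] at h ⊢
  simpa using h

lemma neg_some_eq {x y : ℚ} (h : (twoTorsionCurve a b).toAffine.Nonsingular x y) :
    -(Point.some x y h : Pt a b) = Point.some x (-y) (nonsingular_neg' h) := by
  rw [Point.neg_some]
  exact some_congr rfl (negY_eq x y)

/-- The conditions for `x₁, x₂, x₃` to be the abscissae of the three intersection points of
`y = l x + n` with `y² = x³ + a x² + b x`. -/
structure OnLine (a b l n x₁ x₂ x₃ : ℚ) : Prop where
  sum : x₁ + x₂ + x₃ = l ^ 2 - a
  sum_mul : x₁ * x₂ + x₁ * x₃ + x₂ * x₃ = b - 2 * l * n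
  mul : x₁ * x₂ * x₃ = n ^ 2

lemma slope_eq_of_ne {x₁ x₂ : ℚ} (hx : x₁ ≠ x₂) (y₁ y₂ : ℚ) :
    (twoTorsionCurve a b).toAffine.slope x₁ x₂ y₁ y₂ = (y₁ - y₂) / (x₁ - x₂) :=
  WeierstrassCurve.Affine.slope_of_X_ne hx

lemma slope_self {x y : ℚ} (hy : y ≠ 0) :
    (twoTorsionCurve a b).toAffine.slope x x y y = (3 * x ^ 2 + 2 * a * x + b) / (2 * y) := by
  have : y ≠ (twoTorsionCurve a b).toAffine.negY x y := by
    rw [negY_eq]; intro h; exact hy (by linarith)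
  rw [WeierstrassCurve.Affine.slope_of_Y_ne rfl this, negY_eq]
  simp [twoTorsionCurve, two_mul]

lemma addX_eq (x₁ x₂ l : ℚ) :
    (twoTorsionCurve a b).toAffine.addX x₁ x₂ l = l ^ 2 - a - x₁ - x₂ := by
  simp [WeierstrassCurve.Affine.addX, twoTorsionCurve]

lemma addY_eq (x₁ x₂ y₁ l : ℚ) :
    (twoTorsionCurve a b).toAffine.addY x₁ x₂ y₁ l =
      -(l * (l ^ 2 - a - x₁ - x₂ - x₁) + y₁) := by
  rw [WeierstrassCurve.Affine.addY, negY_eq, WeierstrassCurve.Affine.negAddY, addX_eq]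

/-- Vieta's formulas determine the slope even for a tangent: if x₁ = x₂, they give 3x₁² + 2a x₁ + b
= 2 l y₁, and nonsingularity forces y₁ ≠ 0. With the converse `exists_line`, additivity of a map
becomes a symmetric statement about collinear triples, without separating chords from tangents. -/
lemma add_eq_neg_of_onLine {l n x₁ x₂ x₃ y₁ y₂ y₃ : ℚ} (H : OnLine a b l n x₁ x₂ x₃)
    (h₁ : (twoTorsionCurve a b).toAffine.Nonsingular x₁ y₁)
    (h₂ : (twoTorsionCurve a b).toAffine.Nonsingular x₂ y₂)
    (h₃ : (twoTorsionCurve a b).toAffine.Nonsingular x₃ y₃)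
    (e₁ : y₁ = l * x₁ + n) (e₂ : y₂ = l * x₂ + n) (e₃ : y₃ = l * x₃ + n) :
    (Point.some x₁ y₁ h₁ + Point.some x₂ y₂ h₂ : Pt a b) = -Point.some x₃ y₃ h₃ := by
  obtain ⟨s1, s2, s3⟩ := H
  rw [neg_some_eq h₃]
  have hslope : (¬(x₁ = x₂ ∧ y₁ = (twoTorsionCurve a b).toAffine.negY x₂ y₂)) ∧
      (twoTorsionCurve a b).toAffine.slope x₁ x₂ y₁ y₂ = l := by
    by_cases hx : x₁ = x₂
    · subst hx
      obtain rfl : y₁ = y₂ := e₁.trans e₂.symm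
      have key : 3 * x₁ ^ 2 + 2 * a * x₁ + b = 2 * l * y₁ := by
        linear_combination (-1 : ℚ) * s2 + 2 * x₁ * s1 - 2 * l * e₁
      have hy : y₁ ≠ 0 := by
        rintro rfl
        rcases ((nonsingular_iff_eq _ _).mp h₁).2 with h | h
        · exact h (by rw [key]; ring)
        · exact h rfl
      refine ⟨fun h ↦ hy ?_, ?_⟩
      · have := h.2; rw [negY_eq] at this; linarith
      · rw [slope_self hy, key]; field_simp
    · refine ⟨fun h ↦ hx h.1, ?_⟩
      rw [slope_eq_of_ne hx, div_eq_iff (sub_ne_zero.mpr hx)]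
      linear_combination e₁ - e₂
  rw [Point.add_some hslope.1]
  refine some_congr ?_ ?_
  · rw [hslope.2, addX_eq]; linear_combination -s1
  · rw [hslope.2, addY_eq]; linear_combination l * s1 + e₁ * (-1 : ℚ) + e₃

lemma exists_line {x₁ x₂ x₃ y₁ y₂ y₃ : ℚ}
    (h₁ : (twoTorsionCurve a b).toAffine.Nonsingular x₁ y₁)
    (h₂ : (twoTorsionCurve a b).toAffine.Nonsingular x₂ y₂)
    (h₃ : (twoTorsionCurve a b).toAffine.Nonsingular x₃ y₃)
    (h : (Point.some x₁ y₁ h₁ + Point.some x₂ y₂ h₂ : Pt a b) = -Point.some x₃ y₃ h₃) :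
    ∃ l n, OnLine a b l n x₁ x₂ x₃ ∧ y₁ = l * x₁ + n ∧ y₂ = l * x₂ + n ∧ y₃ = l * x₃ + n := by
  rw [neg_some_eq h₃] at h
  by_cases hxy : x₁ = x₂ ∧ y₁ = (twoTorsionCurve a b).toAffine.negY x₂ y₂
  · rw [Point.add_of_Y_eq hxy.1 hxy.2] at h
    exact absurd h.symm (Point.some_ne_zero _)
  rw [Point.add_some hxy, Point.some.injEq, addX_eq, addY_eq] at h
  obtain ⟨hX, hY⟩ := h
  have q1 := ((nonsingular_iff_eq _ _).mp h₁).1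
  have q2 := ((nonsingular_iff_eq _ _).mp h₂).1
  rw [negY_eq] at hxy
  by_cases hx : x₁ = x₂
  · subst hx
    have hyy : y₁ = y₂ := by
      have : (y₁ - y₂) * (y₁ + y₂) = 0 := by linear_combination q1 - q2
      rcases mul_eq_zero.mp this with h | h
      · linarith
      · exact absurd ⟨rfl, by linarith⟩ hxy
    subst hyy
    have hy : y₁ ≠ 0 := by rintro rfl; simp at hxy
    rw [slope_self hy] at hX hY
    generalize hl : (3 * x₁ ^ 2 + 2 * a * x₁ + b) / (2 * y₁) = l at hX hY
    rw [div_eq_iff (by simpa using hy)] at hl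
    refine ⟨l, y₁ - l * x₁, ⟨by linear_combination -hX, ?_, ?_⟩, by ring, by ring, ?_⟩
    · linear_combination -2 * x₁ * hX - hl
    · linear_combination -x₁ ^ 2 * hX - q1 - x₁ * hl
    · linear_combination hY + l * hX
  · rw [slope_eq_of_ne hx] at hX hY
    generalize hl : (y₁ - y₂) / (x₁ - x₂) = l at hX hY
    have hx' : x₁ - x₂ ≠ 0 := sub_ne_zero.mpr hx
    rw [div_eq_iff hx'] at hl
    have s2 : x₁ * x₂ + x₁ * x₃ + x₂ * x₃ = b - 2 * l * (y₁ - l * x₁) := by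
      apply mul_left_cancel₀ hx'
      linear_combination -(x₁ - x₂) * (x₁ + x₂) * hX + q1 - q2 -
        (y₁ + y₂ - l * (x₁ - x₂)) * hl
    refine ⟨l, y₁ - l * x₁, ⟨by linear_combination -hX, s2, ?_⟩, by ring, ?_, ?_⟩
    · linear_combination x₁ * s2 + x₁ ^ 2 * hX - q1
    · linear_combination -hl
    · linear_combination hY + l * hX

end TwoTorsionCurve

/-! ### The 2-isogeny, its image and its dual. -/

namespace TwoTorsionCurve

/-- The relation between the coefficients of `y² = x³ + a x² + b x` and those of the target of its
`2`-isogeny with kernel `{0, (0, 0)}`, rescaled by `u`. -/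
structure IsogenyData (a b A B u : ℚ) : Prop where
  u_ne_zero : u ≠ 0
  b_ne_zero : b ≠ 0
  disc_ne_zero : a ^ 2 - 4 * b ≠ 0
  A_eq : A = -2 * a * u ^ 2
  B_eq : B = (a ^ 2 - 4 * b) * u ^ 4

namespace IsogenyData

variable {a b A B u : ℚ}

lemma B_ne_zero (D : IsogenyData a b A B u) : B ≠ 0 := by
  rw [D.B_eq]
  exact mul_ne_zero D.disc_ne_zero (pow_ne_zero _ D.u_ne_zero)

lemma disc'_ne_zero (D : IsogenyData a b A B u) : A ^ 2 - 4 * B ≠ 0 := by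
  rw [show A ^ 2 - 4 * B = 16 * b * u ^ 4 by rw [D.A_eq, D.B_eq]; ring]
  exact mul_ne_zero (mul_ne_zero (by norm_num) D.b_ne_zero) (pow_ne_zero _ D.u_ne_zero)

lemma nonsingular_image (D : IsogenyData a b A B u) {x y : ℚ} (hx : x ≠ 0)
    (h : (twoTorsionCurve a b).toAffine.Nonsingular x y) :
    (twoTorsionCurve A B).toAffine.Nonsingular
      (u ^ 2 * (y ^ 2 / x ^ 2)) (u ^ 3 * (y * (x ^ 2 - b) / x ^ 2)) := by
  refine nonsingular_of_eq D.B_ne_zero D.disc'_ne_zero ?_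
  have q := ((nonsingular_iff_eq _ _).mp h).1
  rw [D.A_eq, D.B_eq]
  field_simp
  rw [show y ^ 2 = x ^ 3 + a * x ^ 2 + b * x from q]
  ring

/-- The `2`-isogeny on points. -/
def isogenyFun (D : IsogenyData a b A B u) : Pt a b → Pt A B
  | .zero => 0
  | .some x _ h => if hx : x = 0 then 0 else .some _ _ (D.nonsingular_image hx h)

variable (D : IsogenyData a b A B u)

lemma isogenyFun_zero : D.isogenyFun 0 = 0 := rfl

lemma isogenyFun_some_zero {x y : ℚ} (h : (twoTorsionCurve a b).toAffine.Nonsingular x y)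
    (hx : x = 0) : D.isogenyFun (.some x y h) = 0 := by
  simp [isogenyFun, hx]

lemma isogenyFun_some {x y : ℚ} (h : (twoTorsionCurve a b).toAffine.Nonsingular x y)
    (hx : x ≠ 0) : D.isogenyFun (.some x y h) = .some _ _ (D.nonsingular_image hx h) := by
  simp [isogenyFun, hx]

lemma isogenyFun_neg (P : Pt a b) : D.isogenyFun (-P) = -D.isogenyFun P := by
  rcases P with _ | ⟨x, y, h⟩
  · rfl
  · rw [neg_some_eq h]
    by_cases hx : x = 0
    · rw [D.isogenyFun_some_zero _ hx, D.isogenyFun_some_zero _ hx, neg_zero]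
    · rw [D.isogenyFun_some _ hx, D.isogenyFun_some _ hx, neg_some_eq]
      exact some_congr (by ring) (by ring)

/-- This is the case of a line through (0,0). The third collinear point lies in the kernel, so the
images of the other two must be opposite. -/
lemma isogenyFun_add_eq_zero_of_mul_eq {l x₂ x₃ y₂ y₃ : ℚ}
    (h₂ : (twoTorsionCurve a b).toAffine.Nonsingular x₂ y₂)
    (h₃ : (twoTorsionCurve a b).toAffine.Nonsingular x₃ y₃)
    (hb : x₂ * x₃ = b) (e₂ : y₂ = l * x₂) (e₃ : y₃ = l * x₃) :
    D.isogenyFun (.some x₂ y₂ h₂) + D.isogenyFun (.some x₃ y₃ h₃) = 0 := by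
  have hx₂ : x₂ ≠ 0 := by rintro rfl; exact D.b_ne_zero (by rw [← hb, zero_mul])
  have hx₃ : x₃ ≠ 0 := by rintro rfl; exact D.b_ne_zero (by rw [← hb, mul_zero])
  rw [D.isogenyFun_some _ hx₂, D.isogenyFun_some _ hx₃, add_eq_zero_iff_eq_neg,
    neg_some_eq]
  rw [Point.some.injEq, e₂, e₃, ← hb]
  constructor <;> field_simp
  ring

/-- A line that avoids (0,0) is carried to a line. Multiplied by n² = x₁x₂x₃, each of the three
conditions becomes an identity in the elementary symmetric functions of the xᵢ, which are known in
terms of l and n. -/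
lemma onLine_image (D : IsogenyData a b A B u) {l n x₁ x₂ x₃ : ℚ} (hn : n ≠ 0)
    (H : OnLine a b l n x₁ x₂ x₃)
    (hx₁ : x₁ ≠ 0) (hx₂ : x₂ ≠ 0) (hx₃ : x₃ ≠ 0) :
    OnLine A B (u * (l - b / n)) (u ^ 3 * (n - a * l + b * l ^ 2 / n))
      (u ^ 2 * (x₁ + a + b / x₁)) (u ^ 2 * (x₂ + a + b / x₂)) (u ^ 2 * (x₃ + a + b / x₃)) := by
  obtain ⟨s1, s2, s3⟩ := H
  have hn2 : n ^ 2 ≠ 0 := pow_ne_zero 2 hn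
  constructor
  · have : n ^ 2 * (u ^ 2 * (x₁ + a + b / x₁) + u ^ 2 * (x₂ + a + b / x₂) +
        u ^ 2 * (x₃ + a + b / x₃)) = u ^ 2 * (x₁ * x₂ * x₃ * (x₁ + x₂ + x₃ + 3 * a) +
        b * (x₁ * x₂ + x₁ * x₃ + x₂ * x₃)) := by
      rw [← s3]; field_simp; ring
    apply mul_left_cancel₀ hn2
    rw [this, s1, s2, s3, D.A_eq]
    field_simp; ring
  · have : n ^ 2 * (u ^ 2 * (x₁ + a + b / x₁) * (u ^ 2 * (x₂ + a + b / x₂)) +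
        u ^ 2 * (x₁ + a + b / x₁) * (u ^ 2 * (x₃ + a + b / x₃)) +
        u ^ 2 * (x₂ + a + b / x₂) * (u ^ 2 * (x₃ + a + b / x₃))) =
        u ^ 4 * ((x₁ * x₂ + x₁ * x₃ + x₂ * x₃) * (x₁ * x₂ * x₃) +
        2 * a * (x₁ + x₂ + x₃) * (x₁ * x₂ * x₃) + 3 * a ^ 2 * (x₁ * x₂ * x₃) +
        b * ((x₁ + x₂ + x₃) * (x₁ * x₂ + x₁ * x₃ + x₂ * x₃) - 3 * (x₁ * x₂ * x₃)) +
        2 * a * b * (x₁ * x₂ + x₁ * x₃ + x₂ * x₃) + b ^ 2 * (x₁ + x₂ + x₃)) := by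
      rw [← s3]; field_simp; ring
    apply mul_left_cancel₀ hn2
    rw [this, s1, s2, s3, D.B_eq]
    field_simp; ring
  · have : n ^ 2 * (u ^ 2 * (x₁ + a + b / x₁) * (u ^ 2 * (x₂ + a + b / x₂)) *
        (u ^ 2 * (x₃ + a + b / x₃))) =
        u ^ 6 * ((x₁ * x₂ * x₃) ^ 2 + a * ((x₁ * x₂ + x₁ * x₃ + x₂ * x₃) * (x₁ * x₂ * x₃)) +
          b * ((x₁ * x₂ + x₁ * x₃ + x₂ * x₃) ^ 2 - 2 * (x₁ + x₂ + x₃) * (x₁ * x₂ * x₃)) +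
          a ^ 2 * ((x₁ + x₂ + x₃) * (x₁ * x₂ * x₃)) +
          a * b * ((x₁ + x₂ + x₃) * (x₁ * x₂ + x₁ * x₃ + x₂ * x₃) - 3 * (x₁ * x₂ * x₃)) +
          b ^ 2 * ((x₁ + x₂ + x₃) ^ 2 - 2 * (x₁ * x₂ + x₁ * x₃ + x₂ * x₃)) +
          a ^ 3 * (x₁ * x₂ * x₃) + a ^ 2 * b * (x₁ * x₂ + x₁ * x₃ + x₂ * x₃) +
          a * b ^ 2 * (x₁ + x₂ + x₃) + b ^ 3) := by
      rw [← s3]; field_simp; ring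
    apply mul_left_cancel₀ hn2
    rw [this, s1, s2, s3]
    field_simp; ring

lemma image_x_eq {x y : ℚ} (hx : x ≠ 0) (h : (twoTorsionCurve a b).toAffine.Nonsingular x y) :
    y ^ 2 / x ^ 2 = x + a + b / x := by
  rw [((nonsingular_iff_eq _ _).mp h).1]
  field_simp

lemma image_y_eq {l n x y : ℚ} (hn : n ≠ 0) (hx : x ≠ 0) (e : y = l * x + n)
    (h : (twoTorsionCurve a b).toAffine.Nonsingular x y) :
    u ^ 3 * (y * (x ^ 2 - b) / x ^ 2) =
      u * (l - b / n) * (u ^ 2 * (y ^ 2 / x ^ 2)) + u ^ 3 * (n - a * l + b * l ^ 2 / n) := by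
  have q := ((nonsingular_iff_eq _ _).mp h).1
  subst e
  field_simp
  linear_combination -(u ^ 3 * n * l) * q

lemma isogenyFun_add_eq_neg {P Q R : Pt a b} (h : P + Q = -R) :
    D.isogenyFun P + D.isogenyFun Q = -D.isogenyFun R := by
  rcases P with _ | ⟨x₁, y₁, h₁⟩
  · rw [← Point.zero_def] at h ⊢
    rw [zero_add] at h
    rw [h, isogenyFun_neg, isogenyFun_zero, zero_add]
  rcases Q with _ | ⟨x₂, y₂, h₂⟩
  · rw [← Point.zero_def] at h ⊢
    rw [add_zero] at h
    rw [h, isogenyFun_neg, isogenyFun_zero, add_zero]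
  rcases R with _ | ⟨x₃, y₃, h₃⟩
  · rw [← Point.zero_def] at h ⊢
    rw [neg_zero, add_eq_zero_iff_eq_neg] at h
    rw [h, isogenyFun_neg, isogenyFun_zero, neg_zero, neg_add_cancel]
  obtain ⟨l, n, H, e₁, e₂, e₃⟩ := exists_line h₁ h₂ h₃ h
  by_cases hn : n = 0
  · subst hn
    obtain ⟨s1, s2, s3⟩ := H
    rw [zero_pow two_ne_zero, mul_eq_zero, mul_eq_zero] at s3
    rw [add_zero] at e₁ e₂ e₃
    rcases s3 with (hx | hx) | hx
    · rw [D.isogenyFun_some_zero _ hx, zero_add, ← add_eq_zero_iff_eq_neg]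
      exact D.isogenyFun_add_eq_zero_of_mul_eq h₂ h₃ (by rw [hx] at s2; linear_combination s2) e₂ e₃
    · rw [D.isogenyFun_some_zero h₂ hx, add_zero, ← add_eq_zero_iff_eq_neg]
      exact D.isogenyFun_add_eq_zero_of_mul_eq h₁ h₃ (by rw [hx] at s2; linear_combination s2) e₁ e₃
    · rw [D.isogenyFun_some_zero h₃ hx, neg_zero]
      exact D.isogenyFun_add_eq_zero_of_mul_eq h₁ h₂ (by rw [hx] at s2; linear_combination s2) e₁ e₂
  · have hx : x₁ * x₂ * x₃ ≠ 0 := by rw [H.mul]; exact pow_ne_zero 2 hn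
    obtain ⟨⟨hx₁, hx₂⟩, hx₃⟩ := by simpa only [mul_ne_zero_iff] using hx
    rw [D.isogenyFun_some _ hx₁, D.isogenyFun_some _ hx₂, D.isogenyFun_some _ hx₃]
    refine add_eq_neg_of_onLine (l := u * (l - b / n)) (n := u ^ 3 * (n - a * l + b * l ^ 2 / n))
      ?_ _ _ _ (image_y_eq hn hx₁ e₁ h₁) (image_y_eq hn hx₂ e₂ h₂) (image_y_eq hn hx₃ e₃ h₃)
    rw [image_x_eq hx₁ h₁, image_x_eq hx₂ h₂, image_x_eq hx₃ h₃]
    exact D.onLine_image hn H hx₁ hx₂ hx₃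

/-- The `2`-isogeny with kernel `{0, (0, 0)}` as a group homomorphism. -/
def isogeny : Pt a b →+ Pt A B where
  toFun := D.isogenyFun
  map_zero' := D.isogenyFun_zero
  map_add' P Q := by
    have := D.isogenyFun_add_eq_neg (P := P) (Q := Q) (R := -(P + Q)) (by rw [neg_neg])
    rw [this, isogenyFun_neg, neg_neg]

lemma isogeny_some_zero {x y : ℚ} (h : (twoTorsionCurve a b).toAffine.Nonsingular x y)
    (hx : x = 0) : D.isogeny (.some x y h) = 0 :=
  D.isogenyFun_some_zero h hx

lemma isogeny_some {x y : ℚ} (h : (twoTorsionCurve a b).toAffine.Nonsingular x y)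
    (hx : x ≠ 0) : D.isogeny (.some x y h) = .some _ _ (D.nonsingular_image hx h) :=
  D.isogenyFun_some h hx

/-- A point whose abscissa is a nonzero square is in the image of the isogeny. -/
lemma mem_range_of_eq_sq {x y w : ℚ} (h : (twoTorsionCurve A B).toAffine.Nonsingular x y)
    (hx : x ≠ 0) (hw : x = w ^ 2) : (.some x y h : Pt A B) ∈ D.isogeny.range := by
  have hu := D.u_ne_zero
  have q := ((nonsingular_iff_eq _ _).mp h).1
  have hw0 : w ≠ 0 := by rintro rfl; exact hx (by simpa using hw)
  subst hw
  -- A preimage has abscissa X with u² (X + a + b/X) = w². This is a quadratic equation in X, and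
  -- the curve equation makes its discriminant the square of y/(w u²).
  obtain ⟨X, hX⟩ : ∃ X, X = (w ^ 2 / u ^ 2 - a + y / (w * u ^ 2)) / 2 := ⟨_, rfl⟩
  have hX' : u ^ 2 * w * (2 * X + a) = w ^ 3 + y := by rw [hX]; field_simp; ring
  rw [D.A_eq, D.B_eq] at q
  have key : u ^ 2 * (X ^ 2 + a * X + b) = w ^ 2 * X := by
    have hc : 4 * u ^ 2 * w ^ 2 ≠ 0 := by positivity
    apply mul_left_cancel₀ hc
    linear_combination (u ^ 2 * w * (2 * X + a) + y + w ^ 3 - 2 * w ^ 3) * hX' + q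
  have hX0 : X ≠ 0 := by
    rintro rfl
    have : u ^ 2 * b = 0 := by linear_combination key
    rcases mul_eq_zero.mp this with h | h
    · exact hu (pow_eq_zero_iff two_ne_zero |>.mp h)
    · exact D.b_ne_zero h
  have hns : (twoTorsionCurve a b).toAffine.Nonsingular X (w / u * X) := by
    refine nonsingular_of_eq D.b_ne_zero D.disc_ne_zero ?_
    field_simp
    linear_combination -key
  refine ⟨.some X _ hns, ?_⟩
  rw [D.isogeny_some hns hX0]
  refine some_congr ?_ ?_
  · field_simp
  · field_simp
    have : u ^ 2 * w * (X ^ 2 - b) = y * X := by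
      linear_combination X * hX' - w * key
    linear_combination this

/-- The point `(0, 0)` is in the image of the isogeny if `B` is a square. -/
lemma zero_mem_range_of_eq_sq {y s : ℚ} (h : (twoTorsionCurve A B).toAffine.Nonsingular 0 y)
    (hs : B = s ^ 2) : (.some 0 y h : Pt A B) ∈ D.isogeny.range := by
  have hu := D.u_ne_zero
  have q := ((nonsingular_iff_eq _ _).mp h).1
  have hy : y = 0 := by simpa using q
  -- If B is a square then x² + ax + b splits; (X, 0) with X a root is a 2-torsion point that maps
  -- to (0,0).
  obtain ⟨X, hX⟩ : ∃ X, X = (s / u ^ 2 - a) / 2 := ⟨_, rfl⟩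
  have hX' : u ^ 2 * (2 * X + a) = s := by rw [hX]; field_simp; ring
  have key : X ^ 2 + a * X + b = 0 := by
    have hc : 4 * u ^ 4 ≠ 0 := by positivity
    apply mul_left_cancel₀ hc
    have := D.B_eq
    linear_combination (u ^ 2 * (2 * X + a) + s) * hX' - hs + this
  have hX0 : X ≠ 0 := by
    rintro rfl
    exact D.b_ne_zero (by linear_combination key)
  have hns : (twoTorsionCurve a b).toAffine.Nonsingular X 0 := by
    refine nonsingular_of_eq D.b_ne_zero D.disc_ne_zero ?_
    linear_combination -X * key
  refine ⟨.some X _ hns, ?_⟩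
  rw [D.isogeny_some hns hX0]
  exact some_congr (by simp) (by simp [hy])

/-- If `(0, 0)` is in the image of the isogeny, then `a² - 4 b` is a square. -/
lemma isSquare_of_zero_mem_range {y : ℚ} (h : (twoTorsionCurve A B).toAffine.Nonsingular 0 y)
    (hm : (.some 0 y h : Pt A B) ∈ D.isogeny.range) : IsSquare (a ^ 2 - 4 * b) := by
  obtain ⟨P, hP⟩ := hm
  rcases P with _ | ⟨X, Y, hXY⟩
  · rw [← Point.zero_def, map_zero] at hP
    exact absurd hP.symm (Point.some_ne_zero _)
  by_cases hX : X = 0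
  · rw [D.isogeny_some_zero _ hX] at hP
    exact absurd hP.symm (Point.some_ne_zero _)
  rw [D.isogeny_some _ hX, Point.some.injEq] at hP
  have hu := D.u_ne_zero
  have hY : Y = 0 := by simpa [hu, hX] using hP.1
  have q := ((nonsingular_iff_eq _ _).mp hXY).1
  have : X * (X ^ 2 + a * X + b) = 0 := by rw [hY] at q; linear_combination -q
  have h0 := (mul_eq_zero.mp this).resolve_left hX
  exact ⟨2 * X + a, by linear_combination -4 * h0⟩

/-- Without rescaling, two successive isogenies end on the curve with coefficients 4a and 16b. The
factor uv = 1/2 returns to (a, b), and its sign makes the composite 2 rather than -2. -/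
lemma isogeny_comp_isogeny {v : ℚ} (D' : IsogenyData A B a b v) (huv : 2 * (u * v) = 1)
    (P : Pt a b) : D'.isogeny (D.isogeny P) = (2 : ℕ) • P := by
  rw [two_nsmul]
  rcases P with _ | ⟨x, y, h⟩
  · rw [← Point.zero_def]; simp
  have hu := D.u_ne_zero
  have q := ((nonsingular_iff_eq _ _).mp h).1
  by_cases hy : y = 0
  · rw [Point.add_of_Y_eq rfl (by rw [negY_eq, hy, neg_zero])]
    by_cases hx : x = 0
    · rw [D.isogeny_some_zero _ hx, map_zero]
    · rw [D.isogeny_some _ hx, D'.isogeny_some_zero _ (by simp [hy])]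
  have hx : x ≠ 0 := by rintro rfl; exact hy (by simpa using q)
  rw [D.isogeny_some _ hx, D'.isogeny_some _ (by simp [hx, hy, hu]),
    Point.add_of_Y_ne (by rw [negY_eq]; intro h; exact hy (by linarith))]
  have hv : v = 1 / (2 * u) := by field_simp; linear_combination huv
  have hx2 : y ^ 2 ≠ 0 := pow_ne_zero 2 hy
  refine some_congr ?_ ?_
  · rw [slope_self hy, addX_eq, hv]
    trans (x ^ 2 - b) ^ 2 / (4 * y ^ 2)
    · field_simp; ring
    · field_simp
      linear_combination (16 * (a + 2 * x)) * q
  · rw [slope_self hy, addY_eq, hv, D.B_eq]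
    have hy4 : y ^ 4 = x ^ 2 * (x ^ 2 + a * x + b) ^ 2 := by
      rw [show y ^ 4 = (y ^ 2) ^ 2 by ring, q]; ring
    trans (x ^ 2 - b) * (y ^ 4 - (a ^ 2 - 4 * b) * x ^ 4) / (8 * x ^ 2 * y ^ 3)
    · field_simp; ring
    trans (x ^ 2 - b) * ((x ^ 2 + a * x + b) ^ 2 - (a ^ 2 - 4 * b) * x ^ 2) / (8 * y ^ 3)
    · rw [hy4]; field_simp
    · rw [div_eq_iff (by positivity)]
      have : -((3 * x ^ 2 + 2 * a * x + b) / (2 * y) * (((3 * x ^ 2 + 2 * a * x + b) / (2 * y)) ^ 2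
          - a - x - x - x) + y) * (8 * y ^ 3) = -((3 * x ^ 2 + 2 * a * x + b) ^ 3 -
          4 * y ^ 2 * (3 * x ^ 2 + 2 * a * x + b) * (a + 3 * x) + 8 * (y ^ 2) ^ 2) := by
        field_simp; ring
      rw [this, q]
      ring

end IsogenyData

end TwoTorsionCurve

/-! ### Heights and finite generation. -/

namespace TwoTorsionCurve

variable {a b : ℚ}

lemma addSubMap_eval (s t v : ℚ) :
    (fun i ↦ ((twoTorsionCurve a b).addSubMap i).eval ![s, t, v]) =
      ![s ^ 2 - 2 * b * s * v + b ^ 2 * v ^ 2,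
        2 * t * s + 4 * a * s * v + 2 * b * t * v, t ^ 2 - 4 * s * v] := by
  funext i
  fin_cases i <;>
    simp [WeierstrassCurve.addSubMap, twoTorsionCurve, WeierstrassCurve.b₂, WeierstrassCurve.b₄,
      WeierstrassCurve.b₆, WeierstrassCurve.b₈]

/-- The addition-and-subtraction map sends the symmetric square of the abscissae of `P` and `Q` to
that of `P + Q` and `P - Q`. -/
lemma exists_addSubMap_sym2x (P Q : Pt a b) : ∃ c : ℚ, c ≠ 0 ∧
    (fun i ↦ ((twoTorsionCurve a b).addSubMap i).eval (P.sym2x Q)) =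
      c • (P + Q).sym2x (P - Q) := by
  have hself (P : Pt a b) : ∃ c : ℚ, c ≠ 0 ∧
      (fun i ↦ ((twoTorsionCurve a b).addSubMap i).eval (P.sym2x P)) =
        c • (P + P).sym2x 0 := by
    rcases P with _ | ⟨x, y, h⟩
    · refine ⟨1, one_ne_zero, ?_⟩
      rw [← Point.zero_def, add_zero, Point.sym2x_zero_zero, addSubMap_eval]
      simp
    obtain ⟨q, q'⟩ := (nonsingular_iff_eq _ _).mp h
    rw [Point.sym2x_some_some, addSubMap_eval]
    by_cases hy : y = 0
    · subst hy
      rw [Point.add_of_Y_eq rfl (by rw [negY_eq, neg_zero]), Point.sym2x_zero_zero]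
      have hq : x * (x ^ 2 + a * x + b) = 0 := by linear_combination -q
      refine ⟨(x ^ 2 - b) ^ 2, pow_ne_zero 2 fun h0 ↦ ?_, ?_⟩
      · rcases q' with q' | q'
        · rcases mul_eq_zero.mp hq with hx | hx
          · subst hx; apply q'; linear_combination -h0
          · apply q'; linear_combination 2 * hx + h0
        · exact q' rfl
      · funext i
        fin_cases i
        · simp; ring
        · simp; linear_combination 4 * hq
        · simp; ring
    · rw [Point.add_of_Y_ne (by rw [negY_eq]; intro h; exact hy (by linarith)),
        Point.sym2x_some_zero, addX_eq, slope_self hy]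
      refine ⟨4 * y ^ 2, by positivity, ?_⟩
      funext i
      fin_cases i
      · simp; field_simp
        linear_combination (16 * (a + 2 * x)) * q
      · simp; linear_combination -4 * q
      · simp; ring
  -- Replacing Q by -Q exchanges sum and difference and keeps the abscissa, so the case P = -Q
  -- follows from P = Q.
  have hswap (P Q : Pt a b) (H : ∃ c : ℚ, c ≠ 0 ∧
      (fun i ↦ ((twoTorsionCurve a b).addSubMap i).eval (P.sym2x Q)) =
        c • (P + Q).sym2x (P - Q)) : ∃ c : ℚ, c ≠ 0 ∧
      (fun i ↦ ((twoTorsionCurve a b).addSubMap i).eval (P.sym2x (-Q))) =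
        c • (P + -Q).sym2x (P - -Q) := by
    rwa [Point.sym2x_neg_right, sub_neg_eq_add, ← sub_eq_add_neg, Point.sym2x_comm (P - Q)]
  by_cases hPQ : P = Q
  · subst hPQ
    rw [sub_self]
    exact hself P
  by_cases hPQ' : P = -Q
  · obtain rfl : Q = -P := by rw [hPQ', neg_neg]
    apply hswap
    rw [sub_self]
    exact hself P
  rcases P with _ | ⟨x₁, y₁, h₁⟩
  · rw [← Point.zero_def, zero_add, zero_sub, Point.sym2x_neg_right]
    rcases Q with _ | ⟨x₂, y₂, h₂⟩
    · exact absurd rfl hPQ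
    · refine ⟨1, one_ne_zero, ?_⟩
      rw [Point.sym2x_zero_some, addSubMap_eval, Point.sym2x_some_some]
      funext i
      fin_cases i <;> simp <;> ring
  rcases Q with _ | ⟨x₂, y₂, h₂⟩
  · rw [← Point.zero_def, add_zero, sub_zero]
    refine ⟨1, one_ne_zero, ?_⟩
    rw [Point.sym2x_some_zero, addSubMap_eval, Point.sym2x_some_some]
    funext i
    fin_cases i <;> simp <;> ring
  have hx : x₁ ≠ x₂ := fun h ↦ (Point.X_eq_iff (h₁ := h₁) (h₂ := h₂)).mp h |>.elim hPQ hPQ'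
  have hx' : x₁ - x₂ ≠ 0 := sub_ne_zero.mpr hx
  have q₁ := ((nonsingular_iff_eq _ _).mp h₁).1
  have q₂ := ((nonsingular_iff_eq _ _).mp h₂).1
  refine ⟨(x₁ - x₂) ^ 2, pow_ne_zero 2 hx', ?_⟩
  rw [Point.sym2x_some_some, addSubMap_eval, sub_eq_add_neg (Point.some x₁ y₁ h₁), neg_some_eq,
    Point.add_of_X_ne hx, Point.add_of_X_ne hx, Point.sym2x_some_some, addX_eq, addX_eq,
    slope_eq_of_ne hx, slope_eq_of_ne hx]
  funext i
  fin_cases i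
  · have key : (x₁ - x₂) ^ 2 * ((((y₁ - y₂) / (x₁ - x₂)) ^ 2 - a - x₁ - x₂) *
        (((y₁ - -y₂) / (x₁ - x₂)) ^ 2 - a - x₁ - x₂)) = ((y₁ ^ 2 - y₂ ^ 2) ^ 2 -
        2 * (a + x₁ + x₂) * (x₁ - x₂) ^ 2 * (y₁ ^ 2 + y₂ ^ 2) +
        (a + x₁ + x₂) ^ 2 * (x₁ - x₂) ^ 4) / (x₁ - x₂) ^ 2 := by
      field_simp; ring
    simp only [Fin.zero_eta, Matrix.cons_val_zero, Pi.smul_apply, smul_eq_mul]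
    rw [key, q₁, q₂, eq_div_iff (pow_ne_zero 2 hx')]
    ring
  · have key : (x₁ - x₂) ^ 2 * ((((y₁ - y₂) / (x₁ - x₂)) ^ 2 - a - x₁ - x₂) +
        (((y₁ - -y₂) / (x₁ - x₂)) ^ 2 - a - x₁ - x₂)) = 2 * (y₁ ^ 2 + y₂ ^ 2) -
        2 * (a + x₁ + x₂) * (x₁ - x₂) ^ 2 := by
      field_simp; ring
    simp only [Fin.mk_one, Matrix.cons_val_one, Matrix.cons_val_zero, Pi.smul_apply, smul_eq_mul]
    rw [key, q₁, q₂]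
    ring
  · simp; ring

/-- The naive height of a point. -/
noncomputable def naiveHeight (P : Pt a b) : ℝ := Height.logHeight P.xRep

/-- The height of the symmetric square of two abscissae is the sum of their heights up to a
constant, and the addition-and-subtraction map doubles heights up to a constant. The factor c of
`exists_addSubMap_sym2x` does not affect a projective height. -/
lemma abs_naiveHeight_parallelogram (hb : b ≠ 0) (hd : a ^ 2 - 4 * b ≠ 0) :
    ∃ C : ℝ, ∀ P Q : Pt a b, |naiveHeight (P + Q) + naiveHeight (P - Q) -
      2 * (naiveHeight P + naiveHeight Q)| ≤ C := by
  have : (twoTorsionCurve a b).IsElliptic := by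
    refine ⟨isUnit_iff_ne_zero.mpr ?_⟩
    rw [show (twoTorsionCurve a b).Δ = 16 * b ^ 2 * (a ^ 2 - 4 * b) by
      simp [WeierstrassCurve.Δ, twoTorsionCurve, WeierstrassCurve.b₂, WeierstrassCurve.b₄,
        WeierstrassCurve.b₆, WeierstrassCurve.b₈]; ring]
    positivity
  obtain ⟨C₁, hC₁⟩ := (twoTorsionCurve a b).abs_logHeight_addSubMap_sub_two_mul_logHeight_le
  obtain ⟨C₂, hC₂⟩ := Height.abs_logHeight_sym2_sub_le ℚ
  have hsym (P Q : Pt a b) :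
      |Height.logHeight (P.sym2x Q) - (naiveHeight P + naiveHeight Q)| ≤ C₂ := by
    have hvec (P : Pt a b) : P.xRep = ![P.xRep 0, P.xRep 1] := by
      funext i; fin_cases i <;> rfl
    have hP := P.xRep_ne_zero
    have hQ := Q.xRep_ne_zero
    rw [hvec P] at hP
    rw [hvec Q] at hQ
    have := hC₂ hP hQ
    rw [← hvec P, ← hvec Q] at this
    exact this
  refine ⟨C₁ + 3 * C₂, fun P Q ↦ ?_⟩
  obtain ⟨c, hc, h⟩ := exists_addSubMap_sym2x P Q
  have h1 := hC₁ (P.sym2x Q)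
  rw [h, Height.logHeight_smul_eq_logHeight _ hc] at h1
  have h2 := hsym P Q
  have h3 := hsym (P + Q) (P - Q)
  rw [abs_le] at *
  constructor <;> linarith

instance northcott_naiveHeight : Northcott (naiveHeight : Pt a b → ℝ) where
  finite_le B := by
    -- Only finitely many abscissae have bounded height, and an abscissa determines its point up to
    -- sign.
    refine Set.Finite.of_finite_fibers (fun P : Pt a b ↦ P.xRep) ?_ fun v _ ↦ ?_
    · refine ((Set.finite_singleton (![1, 0] : Fin 2 → ℚ)).union
        ((Northcott.finite_le (h := Height.logHeight₁ (K := ℚ)) B).image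
          fun x ↦ (![x, 1] : Fin 2 → ℚ))).subset ?_
      rintro _ ⟨P, hP, rfl⟩
      rcases P with _ | ⟨x, y, h⟩
      · exact Or.inl rfl
      · refine Or.inr ⟨x, ?_, rfl⟩
        have : naiveHeight (Point.some x y h : Pt a b) ≤ B := hP
        rw [naiveHeight, Point.xRep_some] at this
        rw [Set.mem_ofPred_eq, Height.logHeight₁_eq_logHeight]
        exact this
    · rcases Set.eq_empty_or_nonempty ({P : Pt a b | naiveHeight P ≤ B} ∩
        (fun P : Pt a b ↦ P.xRep) ⁻¹' {v}) with h | ⟨P, _, hP⟩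
      · rw [h]; exact Set.finite_empty
      · refine (Set.toFinite ({P, -P} : Set (Pt a b))).subset ?_
        rintro Q ⟨_, hQ⟩
        exact Point.eq_or_eq_neg_of_xRep_eq_xRep (hQ.trans hP.symm)

/-- The weak Mordell–Weil theorem implies the Mordell–Weil theorem. -/
lemma fg_of_finiteIndex (hb : b ≠ 0) (hd : a ^ 2 - 4 * b ≠ 0)
    (h : (nsmulAddMonoidHom (α := Pt a b) 2).range.FiniteIndex) : AddGroup.FG (Pt a b) := by
  obtain ⟨C, hC⟩ := abs_naiveHeight_parallelogram hb hd
  exact AddCommGroup.fg_of_descent' (h := naiveHeight) h (fun P ↦ Height.logHeight_nonneg _) hC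

end TwoTorsionCurve

/-! ### Ranks and indices in abstract abelian groups. -/

lemma rank_le_of_ker_torsion {A B : Type} [AddCommGroup A] [AddCommGroup B] (f : A →+ B)
    (hf : ∀ x, f x = 0 → ∃ n : ℤ, n ≠ 0 ∧ n • x = 0) : Module.rank ℤ A ≤ Module.rank ℤ B := by
  rw [Module.rank_def ℤ A]
  refine ciSup_le' fun ⟨s, hs⟩ ↦ ?_
  have hs' : LinearIndependent ℤ (Subtype.val : s → A) := hs
  have : LinearIndependent ℤ fun i : s ↦ f i.1 := by
    rw [linearIndependent_iff'] at hs' ⊢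
    intro t g hg i hi
    have h1 : f (∑ i ∈ t, g i • (i : A)) = 0 := by simpa using hg
    obtain ⟨n, hn, h2⟩ := hf _ h1
    rw [Finset.smul_sum] at h2
    have := hs' t (fun i ↦ n * g i) (by simpa [mul_smul] using h2) i hi
    exact (mul_eq_zero.mp this).resolve_left hn
  exact this.cardinal_le_rank

/-- Write A = ℤⁿ × D with D finite. Then A/2A surjects onto (ℤ/2)ⁿ × D/2D, and |D/2D| = |D[2]| ≥ 2
because t has its nonzero component in D. This torsion contribution is the extra factor 2. -/
lemma two_pow_succ_le_index {A : Type} [AddCommGroup A] [AddGroup.FG A] {t : A} (ht : t ≠ 0)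
    (ht2 : (2 : ℕ) • t = 0) (h0 : (nsmulAddMonoidHom (α := A) 2).range.FiniteIndex) :
    ∃ n : ℕ, Module.rank ℤ A ≤ n ∧ 2 ^ (n + 1) ≤ (nsmulAddMonoidHom (α := A) 2).range.index := by
  obtain ⟨n, ι, _, q, hq, e, ⟨E⟩⟩ := AddCommGroup.equiv_free_prod_directSum_zmod A
  set D := DirectSum ι fun i ↦ ZMod (q i ^ e i) with hD
  have hfin : Finite D := by
    have (i : ι) : NeZero (q i ^ e i) := ⟨pow_ne_zero _ (hq i).ne_zero⟩
    classical
    exact Finite.of_equiv _ (DirectSum.addEquivProd fun i ↦ ZMod (q i ^ e i)).symm.toEquiv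
  refine ⟨n, ?_, ?_⟩
  · let f : A →+ (Fin n →₀ ℤ) := (AddMonoidHom.fst _ _).comp E.toAddMonoidHom
    refine (rank_le_of_ker_torsion f fun x hx ↦ ?_).trans (by simp)
    refine ⟨Nat.card D, by exact_mod_cast Nat.card_pos.ne', E.injective ?_⟩
    rw [map_zsmul, map_zero]
    refine Prod.ext ?_ ?_
    · rw [Prod.smul_fst, show (E x).1 = 0 from hx, smul_zero]; rfl
    · rw [Prod.smul_snd, natCast_zsmul]
      exact card_nsmul_eq_zero'
  · let d : D →+ D := nsmulAddMonoidHom 2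
    let r : (Fin n →₀ ℤ) →+ (Fin n → ZMod 2) :=
      { toFun := fun v i ↦ (v i : ZMod 2)
        map_zero' := by ext; simp
        map_add' := fun v w ↦ by ext; simp }
    have hr : Function.Surjective r := fun w ↦ by
      refine ⟨Finsupp.equivFunOnFinite.symm fun i ↦ (w i).val, ?_⟩
      ext i
      simp [r]
    let F : A →+ (Fin n → ZMod 2) × (D ⧸ d.range) :=
      (AddMonoidHom.prodMap r (QuotientAddGroup.mk' d.range)).comp E.toAddMonoidHom
    have hF : Function.Surjective F :=
      (Function.Surjective.prodMap hr (QuotientAddGroup.mk'_surjective _)).comp E.surjective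
    have hle : (nsmulAddMonoidHom (α := A) 2).range ≤ F.ker := by
      rintro _ ⟨x, rfl⟩
      rw [AddMonoidHom.mem_ker, nsmulAddMonoidHom_apply, map_nsmul]
      refine Prod.ext ?_ ?_
      · funext i
        change (2 : ℕ) • (F x).1 i = 0
        rw [nsmul_eq_mul]
        exact (by decide : ∀ z : ZMod 2, ((2 : ℕ) : ZMod 2) * z = 0) _
      · change (2 : ℕ) • (QuotientAddGroup.mk' d.range (E x).2) = 0
        rw [← map_nsmul]
        exact (QuotientAddGroup.eq_zero_iff _).mpr ⟨(E x).2, rfl⟩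
    have hindex : F.ker.index = 2 ^ n * d.range.index := by
      rw [AddSubgroup.index_ker, AddMonoidHom.range_eq_top.mpr hF, Nat.card_congr
        (AddSubgroup.topEquiv.toEquiv), Nat.card_prod]
      simp [AddSubgroup.index]
    have h2 : 2 ≤ d.range.index := by
      have hmul := d.range.card_mul_index
      have hker := d.ker.card_mul_index
      rw [AddSubgroup.index_ker] at hker
      have h3 : d.range.index = Nat.card d.ker := by
        have : 0 < Nat.card d.range := Nat.card_pos
        apply Nat.eq_of_mul_eq_mul_left this
        rw [hmul, mul_comm, hker]
      have hEt : (E t).1 = 0 := by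
        have : (2 : ℕ) • (E t).1 = 0 := by
          rw [← Prod.smul_fst, ← map_nsmul, ht2, map_zero]; rfl
        ext i
        have := DFunLike.congr_fun this i
        simpa using this
      have hEt2 : (E t).2 ≠ 0 := fun h ↦ ht (E.injective (by
        rw [map_zero]; exact Prod.ext hEt h))
      have hmem : (E t).2 ∈ d.ker := by
        rw [AddMonoidHom.mem_ker]
        change (2 : ℕ) • (E t).2 = 0
        rw [← Prod.smul_snd, ← map_nsmul, ht2, map_zero]; rfl
      rw [h3]
      have : Nontrivial d.ker := ⟨⟨_, hmem⟩, 0, fun h ↦ hEt2 (congrArg Subtype.val h)⟩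
      exact Finite.one_lt_card
    calc 2 ^ (n + 1) = 2 ^ n * 2 := pow_succ 2 n
      _ ≤ 2 ^ n * d.range.index := Nat.mul_le_mul_left _ h2
      _ = F.ker.index := hindex.symm
      _ ≤ _ := Nat.le_of_dvd (Nat.pos_of_ne_zero h0.index_ne_zero)
        (AddSubgroup.index_dvd_of_le hle)

section Isogeny

variable {A A' : Type} [AddCommGroup A] [AddCommGroup A'] {φ : A →+ A'} {φ' : A' →+ A}

lemma range_nsmul_two_eq_map (h : ∀ x, φ' (φ x) = (2 : ℕ) • x) :
    (nsmulAddMonoidHom (α := A) 2).range = φ.range.map φ' := by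
  rw [AddMonoidHom.map_range]
  congr 1
  ext x
  exact (h x).symm

lemma finiteIndex_range_nsmul_two (h : ∀ x, φ' (φ x) = (2 : ℕ) • x) (h0 : φ.range.index ≠ 0)
    (h0' : φ'.range.index ≠ 0) : (nsmulAddMonoidHom (α := A) 2).range.FiniteIndex := by
  refine ⟨?_⟩
  rw [range_nsmul_two_eq_map h, AddSubgroup.index_map]
  refine mul_ne_zero (fun h ↦ h0 ?_) h0'
  exact Nat.eq_zero_of_zero_dvd (h ▸ AddSubgroup.index_dvd_of_le le_sup_left)

/-- If the kernel of `φ'` is not contained in the image of `φ`, then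
`2 [A : 2 A] ≤ [A' : φ A] [A : φ' A']`. -/
lemma two_mul_index_range_nsmul_two_le (h : ∀ x, φ' (φ x) = (2 : ℕ) • x)
    (h0 : φ.range.index ≠ 0) {t' : A'} (ht' : φ' t' = 0) (htr : t' ∉ φ.range) :
    2 * (nsmulAddMonoidHom (α := A) 2).range.index ≤ φ.range.index * φ'.range.index := by
  -- Here [A : φ'(φA)] = [A' : φA + ker φ'] · [A : φ'A'], and t' makes φA + ker φ' strictly larger
  -- than φA.
  rw [range_nsmul_two_eq_map h, AddSubgroup.index_map, ← mul_assoc]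
  refine Nat.mul_le_mul_right _ ?_
  have hle : φ.range ≤ φ.range ⊔ φ'.ker := le_sup_left
  have hmul := AddSubgroup.relIndex_mul_index hle
  rw [← hmul]
  refine Nat.mul_le_mul_right _ ?_
  have h1 : φ.range.relIndex (φ.range ⊔ φ'.ker) ≠ 0 := fun h ↦ h0 (by rw [← hmul, h, zero_mul])
  have h2 : φ.range.relIndex (φ.range ⊔ φ'.ker) ≠ 1 := fun h ↦
    htr (AddSubgroup.relIndex_eq_one.mp h ((le_sup_right : φ'.ker ≤ _) ht'))
  omega

lemma rank_le_of_comp_eq_two (h : ∀ x, φ' (φ x) = (2 : ℕ) • x) :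
    Module.rank ℤ A ≤ Module.rank ℤ A' :=
  rank_le_of_ker_torsion φ fun x hx ↦ ⟨2, two_ne_zero, by
    have := h x
    rw [hx, map_zero] at this
    exact_mod_cast this.symm⟩

lemma rank_le_of_index_mul_le [AddGroup.FG A] (h : ∀ x, φ' (φ x) = (2 : ℕ) • x)
    (h0 : φ.range.index ≠ 0) (h0' : φ'.range.index ≠ 0) {t : A} (ht : t ≠ 0)
    (ht2 : (2 : ℕ) • t = 0) {t' : A'} (ht' : φ' t' = 0) (htr : t' ∉ φ.range) {m : ℕ}
    (hm : φ.range.index * φ'.range.index ≤ 2 ^ (m + 2)) : Module.rank ℤ A ≤ m := by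
  obtain ⟨n, hn, hn'⟩ := two_pow_succ_le_index ht ht2 (finiteIndex_range_nsmul_two h h0 h0')
  have := two_mul_index_range_nsmul_two_le h h0 ht' htr
  have h3 : 2 ^ (n + 2) ≤ 2 ^ (m + 2) := by
    calc 2 ^ (n + 2) = 2 * 2 ^ (n + 1) := by ring
      _ ≤ _ := (Nat.mul_le_mul_left 2 hn').trans (this.trans hm)
  have h4 : n + 2 ≤ m + 2 := (Nat.pow_le_pow_iff_right (by norm_num)).mp h3
  exact hn.trans (by exact_mod_cast (by omega : n ≤ m))

end Isogeny

/-! ### Square classes and the descent homomorphism. -/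

lemma Nat.isSquare_of_forall_even_padicValNat {m : ℕ} (hm : m ≠ 0)
    (h : ∀ l : ℕ, l.Prime → Even (padicValNat l m)) : IsSquare m := by
  obtain ⟨c, d, hcd, hc⟩ := Nat.sq_mul_squarefree m
  have hd0 : d ≠ 0 := by rintro rfl; exact hm (by rw [← hcd]; simp)
  by_cases hc1 : c = 1
  · exact ⟨d, by rw [← hcd, hc1]; ring⟩
  obtain ⟨l, hl, hlc⟩ := Nat.exists_prime_and_dvd hc1
  have : Fact l.Prime := ⟨hl⟩
  have h1 : padicValNat l c = 1 := by
    refine le_antisymm ?_ (one_le_padicValNat_of_dvd hc.ne_zero hlc)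
    by_contra! h2
    have h3 : l ^ 2 ∣ c := (padicValNat_dvd_iff_le hc.ne_zero).mpr h2
    exact hl.one_lt.ne' (Nat.isUnit_iff.mp (hc l (by rwa [← sq])))
  have h2 := h l hl
  rw [← hcd, padicValNat.mul (pow_ne_zero 2 hd0) hc.ne_zero, padicValNat.pow, h1] at h2
  exact absurd h2 (by simp)

lemma Rat.isSquare_of_forall_even_padicValRat {q : ℚ} (hq : 0 < q)
    (h : ∀ l : ℕ, l.Prime → Even (padicValRat l q)) : IsSquare q := by
  have hnum : 0 < q.num := Rat.num_pos.mpr hq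
  have hden : (q.den : ℚ) ≠ 0 := by exact_mod_cast q.den_ne_zero
  obtain ⟨m, hm⟩ := Int.eq_ofNat_of_zero_le hnum.le
  have hq' : q = ((m * q.den : ℕ) : ℚ) / (q.den : ℚ) ^ 2 := by
    conv_lhs => rw [← Rat.num_div_den q, hm]
    push_cast
    field_simp
  have hm0 : m * q.den ≠ 0 := mul_ne_zero (by omega) q.den_ne_zero
  obtain ⟨r, hr⟩ := Nat.isSquare_of_forall_even_padicValNat hm0 fun l hl ↦ by
    have : Fact l.Prime := ⟨hl⟩
    have h1 := h l hl
    rw [hq', padicValRat.div (by exact_mod_cast hm0) (pow_ne_zero 2 hden), padicValRat.pow,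
      padicValRat.of_nat, Int.even_sub] at h1
    exact_mod_cast h1.mpr (by simp)
  exact ⟨r / q.den, hq'.trans (by rw [hr]; push_cast; ring)⟩

namespace TwoTorsionCurve

/-- The target of the descent map: the parities of the sign, the `2`-adic and the `p`-adic
valuation. -/
abbrev Parity : Type := ZMod 2 × ZMod 2 × ZMod 2

/-- The parities of the sign, the `2`-adic and the `p`-adic valuation of a rational number. -/
def parity (p : ℕ) (q : ℚ) : Parity :=
  (if q < 0 then 1 else 0, (padicValRat 2 q : ℤ), (padicValRat p q : ℤ))

lemma Parity.add_self (v : Parity) : v + v = 0 := by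
  revert v; decide

variable {p : ℕ} [Fact p.Prime]

lemma parity_mul {q r : ℚ} (hq : q ≠ 0) (hr : r ≠ 0) :
    parity p (q * r) = parity p q + parity p r := by
  refine Prod.ext ?_ (Prod.ext ?_ ?_)
  · simp only [parity, Prod.fst_add]
    rcases hq.lt_or_gt with h | h <;> rcases hr.lt_or_gt with h' | h'
    · rw [if_neg (mul_pos_of_neg_of_neg h h').not_gt, if_pos h, if_pos h']; rfl
    · rw [if_pos (mul_neg_of_neg_of_pos h h'), if_pos h, if_neg h'.not_gt]; rfl
    · rw [if_pos (mul_neg_of_pos_of_neg h h'), if_neg h.not_gt, if_pos h']; rfl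
    · rw [if_neg (mul_pos h h').not_gt, if_neg h.not_gt, if_neg h'.not_gt]; rfl
  · simp [parity, padicValRat.mul hq hr]
  · simp [parity, padicValRat.mul hq hr]

lemma parity_sq {q : ℚ} (hq : q ≠ 0) : parity p (q ^ 2) = 0 := by
  rw [sq, parity_mul hq hq, Parity.add_self]

lemma isSquare_of_parity_eq_zero {q : ℚ} (hq : q ≠ 0) (h : parity p q = 0)
    (hl : ∀ l : ℕ, l.Prime → l ≠ 2 → l ≠ p → Even (padicValRat l q)) : IsSquare q := by
  have h1 : ¬ q < 0 := by
    intro hlt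
    have := congrArg Prod.fst h
    simp [parity, hlt] at this
  refine Rat.isSquare_of_forall_even_padicValRat (lt_of_le_of_ne (not_lt.mp h1) hq.symm)
    fun l hlp ↦ ?_
  by_cases h2 : l = 2
  · subst h2
    exact even_iff_two_dvd.mpr
      ((ZMod.intCast_zmod_eq_zero_iff_dvd _ 2).mp (congrArg (fun v : Parity ↦ v.2.1) h))
  by_cases h3 : l = p
  · subst h3
    exact even_iff_two_dvd.mpr
      ((ZMod.intCast_zmod_eq_zero_iff_dvd _ 2).mp (congrArg (fun v : Parity ↦ v.2.2) h))
  exact hl l hlp h2 h3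

section Descent

variable {a b : ℚ}

/-- The descent map on points: the class of the abscissa, with `(0, 0)` mapped to the class of
`b`. -/
def descentFun (p : ℕ) : Pt a b → Parity
  | .zero => 0
  | .some x _ _ => if x = 0 then parity p b else parity p x

lemma descentFun_neg {p : ℕ} (P : Pt a b) : descentFun p (-P) = descentFun p P := by
  rcases P with _ | ⟨x, y, h⟩
  · rfl
  · rfl

/-- For three points on y = lx + n the product of the abscissae is n², so their classes add up to
zero. If n = 0, one point is (0,0) and the other two abscissae have product b, which explains the
value assigned to (0,0). -/
lemma descentFun_add_eq (hb : b ≠ 0) {P Q R : Pt a b} (h : P + Q = -R) :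
    descentFun p P + descentFun p Q = descentFun p R := by
  have h0 : descentFun p (0 : Pt a b) = 0 := rfl
  rcases P with _ | ⟨x₁, y₁, h₁⟩
  · rw [← Point.zero_def] at h ⊢
    rw [zero_add] at h
    rw [h, descentFun_neg, h0, zero_add]
  rcases Q with _ | ⟨x₂, y₂, h₂⟩
  · rw [← Point.zero_def] at h ⊢
    rw [add_zero] at h
    rw [h, descentFun_neg, h0, add_zero]
  rcases R with _ | ⟨x₃, y₃, h₃⟩
  · rw [← Point.zero_def] at h ⊢
    rw [neg_zero, add_eq_zero_iff_eq_neg] at h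
    rw [h, descentFun_neg, h0, Parity.add_self]
  obtain ⟨l, n, ⟨s1, s2, s3⟩, e₁, e₂, e₃⟩ := exists_line h₁ h₂ h₃ h
  simp only [descentFun]
  have key {x x' : ℚ} (hx : x * x' = b) : x ≠ 0 ∧ x' ≠ 0 ∧ parity p b = parity p x + parity p x' := by
    have h1 : x ≠ 0 := by rintro rfl; exact hb (by rw [← hx, zero_mul])
    have h2 : x' ≠ 0 := by rintro rfl; exact hb (by rw [← hx, mul_zero])
    exact ⟨h1, h2, by rw [← hx, parity_mul h1 h2]⟩
  have hcancel (v w : Parity) : v + w + w = v := by rw [add_assoc, Parity.add_self, add_zero]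
  by_cases hn : n = 0
  · subst hn
    rw [zero_pow two_ne_zero, mul_eq_zero, mul_eq_zero] at s3
    rcases s3 with (hx | hx) | hx
    · obtain ⟨k1, k2, k3⟩ := key (x := x₂) (x' := x₃) (by rw [hx] at s2; linear_combination s2)
      rw [if_pos hx, if_neg k1, if_neg k2, k3, add_comm (parity p x₂), hcancel]
    · obtain ⟨k1, k2, k3⟩ := key (x := x₁) (x' := x₃) (by rw [hx] at s2; linear_combination s2)
      rw [if_pos hx, if_neg k1, if_neg k2, k3, ← add_assoc, Parity.add_self, zero_add]
    · obtain ⟨k1, k2, k3⟩ := key (x := x₁) (x' := x₂) (by rw [hx] at s2; linear_combination s2)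
      rw [if_pos hx, if_neg k1, if_neg k2, k3]
  · have hx : x₁ * x₂ * x₃ ≠ 0 := by rw [s3]; exact pow_ne_zero 2 hn
    obtain ⟨⟨hx₁, hx₂⟩, hx₃⟩ := by simpa only [mul_ne_zero_iff] using hx
    rw [if_neg hx₁, if_neg hx₂, if_neg hx₃]
    have := parity_sq (p := p) hn
    rw [← s3, parity_mul (mul_ne_zero hx₁ hx₂) hx₃, parity_mul hx₁ hx₂] at this
    rw [← hcancel (parity p x₁ + parity p x₂) (parity p x₃), this, zero_add]

/-- The descent homomorphism. -/
def descentHom (p : ℕ) [Fact p.Prime] (hb : b ≠ 0) : Pt a b →+ Parity where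
  toFun := descentFun p
  map_zero' := rfl
  map_add' P Q := by
    rw [descentFun_add_eq hb (P := P) (Q := Q) (R := -(P + Q)) (by rw [neg_neg]), descentFun_neg]

lemma descentHom_some (hb : b ≠ 0) {x y : ℚ} (hx : x ≠ 0)
    (h : (twoTorsionCurve a b).toAffine.Nonsingular x y) :
    descentHom p hb (.some x y h) = parity p x :=
  if_neg hx

lemma descentHom_some_zero (hb : b ≠ 0) {x y : ℚ} (hx : x = 0)
    (h : (twoTorsionCurve a b).toAffine.Nonsingular x y) :
    descentHom p hb (.some x y h) = parity p b :=
  if_pos hx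

end Descent

/-! ### Local constraints on the descent image and the 2-coverings. -/

section Valuation

variable {a b : ℤ}

/-- With x = m/d in lowest terms, m d K is a square for K = m² + amd + bd². If l divides m or d, it
divides only one of them and, as l ∤ b, it does not divide K; so v(m) + v(d) is even. -/
lemma even_padicValRat_of_not_dvd {l : ℕ} (hl : l.Prime) (hlb : ¬ (l : ℤ) ∣ b) {x y : ℚ}
    (hx : x ≠ 0) (h : y ^ 2 = x ^ 3 + a * x ^ 2 + b * x) : Even (padicValRat l x) := by
  have : Fact l.Prime := ⟨hl⟩
  have hl' : Prime (l : ℤ) := Nat.prime_iff_prime_int.mp hl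
  obtain ⟨m, hm⟩ : ∃ m, m = x.num := ⟨_, rfl⟩
  obtain ⟨d, hd⟩ : ∃ d : ℤ, d = x.den := ⟨_, rfl⟩
  have hm0 : m ≠ 0 := by rw [hm]; exact Rat.num_ne_zero.mpr hx
  have hd0 : d ≠ 0 := by rw [hd]; exact_mod_cast x.den_ne_zero
  have hdq : (d : ℚ) ≠ 0 := by exact_mod_cast hd0
  have hcop : (l : ℤ) ∣ m → ¬ (l : ℤ) ∣ d := by
    intro h1 h2
    have h3 := x.reduced
    rw [hm] at h1
    rw [hd] at h2
    have h4 : l ∣ x.num.natAbs := Int.natCast_dvd.mp h1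
    have h5 : l ∣ x.den := by exact_mod_cast h2
    exact hl.one_lt.ne' (Nat.dvd_one.mp (h3 ▸ Nat.dvd_gcd h4 h5))
  have hxq : x = m / d := by
    rw [hm, hd]; exact_mod_cast (Rat.num_div_den x).symm
  obtain ⟨K, hK⟩ : ∃ K, K = m ^ 2 + a * m * d + b * d ^ 2 := ⟨_, rfl⟩
  have hsq : (y * d ^ 2) ^ 2 = ((m * d * K : ℤ) : ℚ) := by
    rw [mul_pow, h, hxq, hK]
    push_cast
    field_simp
  have hvx : padicValRat l x = padicValInt l m - padicValInt l d := by
    rw [hxq, padicValRat.div (by exact_mod_cast hm0) hdq, padicValRat.of_int, padicValRat.of_int]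
  have heven (hlK : ¬ (l : ℤ) ∣ K) : Even ((padicValInt l m : ℤ) + padicValInt l d) := by
    have hK0 : K ≠ 0 := by rintro rfl; exact hlK (dvd_zero _)
    have h1 := congrArg (padicValRat l) hsq
    rw [padicValRat.pow, padicValRat.of_int, padicValInt.mul (mul_ne_zero hm0 hd0) hK0,
      padicValInt.mul hm0 hd0, padicValInt.eq_zero_of_not_dvd hlK] at h1
    refine ⟨padicValRat l (y * d ^ 2), ?_⟩
    push_cast at h1
    linarith
  rw [hvx, Int.even_sub, ← Int.even_add]
  by_cases h1 : (l : ℤ) ∣ m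
  · refine heven fun h2 ↦ hcop h1 ?_
    have h3 : (l : ℤ) ∣ b * d ^ 2 := by
      rw [hK] at h2
      have : b * d ^ 2 = (m ^ 2 + a * m * d + b * d ^ 2) - m * (m + a * d) := by ring
      rw [this]
      exact dvd_sub h2 (dvd_mul_of_dvd_left h1 _)
    exact hl'.dvd_of_dvd_pow ((hl'.dvd_or_dvd h3).resolve_left hlb)
  · by_cases h2 : (l : ℤ) ∣ d
    · refine heven fun h3 ↦ h1 ?_
      rw [hK] at h3
      have : m ^ 2 = (m ^ 2 + a * m * d + b * d ^ 2) - d * (a * m + b * d) := by ring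
      refine hl'.dvd_of_dvd_pow (n := 2) ?_
      rw [this]
      exact dvd_sub h3 (dvd_mul_of_dvd_left h2 _)
    · rw [padicValInt.eq_zero_of_not_dvd h1, padicValInt.eq_zero_of_not_dvd h2]
      simp

lemma nonneg_of_eq {a b x y : ℚ} (hab : a ^ 2 - 4 * b < 0 ∨ 0 < b ∧ a < 0)
    (h : y ^ 2 = x ^ 3 + a * x ^ 2 + b * x) : 0 ≤ x := by
  by_contra! hx
  have h1 : 0 < x ^ 2 + a * x + b := by
    rcases hab with h2 | ⟨h2, h3⟩
    · nlinarith [sq_nonneg (2 * x + a)]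
    · nlinarith [mul_pos_of_neg_of_neg h3 hx, sq_nonneg x]
  nlinarith [mul_neg_of_neg_of_pos hx h1, sq_nonneg y]

variable (hb : (b : ℚ) ≠ 0)

lemma descentHom_fst_eq_zero (hab : a ^ 2 - 4 * b < 0 ∨ 0 < b ∧ a < 0) (P : Pt (a : ℚ) (b : ℚ)) :
    (descentHom p hb P).1 = 0 := by
  have hab' : (a : ℚ) ^ 2 - 4 * b < 0 ∨ 0 < (b : ℚ) ∧ (a : ℚ) < 0 := by exact_mod_cast hab
  rcases P with _ | ⟨x, y, h⟩
  · rfl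
  by_cases hx : x = 0
  · rw [descentHom_some_zero hb hx]
    have : ¬ (b : ℚ) < 0 := by
      rcases hab' with h | h
      · nlinarith [sq_nonneg (a : ℚ)]
      · exact h.1.not_gt
    exact if_neg this
  · rw [descentHom_some hb hx]
    exact if_neg (nonneg_of_eq hab' ((nonsingular_iff_eq _ _).mp h).1).not_gt

lemma intCast_zmod_two_eq_zero {z : ℤ} (h : Even z) : (z : ZMod 2) = 0 :=
  (ZMod.intCast_zmod_eq_zero_iff_dvd _ 2).mpr h.two_dvd

lemma descentHom_snd_eq_zero (h2 : ¬ 2 ∣ b) (P : Pt (a : ℚ) (b : ℚ)) :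
    (descentHom p hb P).2.1 = 0 := by
  rcases P with _ | ⟨x, y, h⟩
  · rfl
  by_cases hx : x = 0
  · rw [descentHom_some_zero hb hx]
    refine intCast_zmod_two_eq_zero ?_
    rw [padicValRat.of_int, padicValInt.eq_zero_of_not_dvd (by exact_mod_cast h2)]
    simp
  · rw [descentHom_some hb hx]
    exact intCast_zmod_two_eq_zero (even_padicValRat_of_not_dvd Nat.prime_two
      (by exact_mod_cast h2) hx ((nonsingular_iff_eq _ _).mp h).1)

lemma descentHom_trd_eq_zero (h2 : ¬ (p : ℤ) ∣ b) (P : Pt (a : ℚ) (b : ℚ)) :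
    (descentHom p hb P).2.2 = 0 := by
  rcases P with _ | ⟨x, y, h⟩
  · rfl
  by_cases hx : x = 0
  · rw [descentHom_some_zero hb hx]
    refine intCast_zmod_two_eq_zero ?_
    rw [padicValRat.of_int, padicValInt.eq_zero_of_not_dvd h2]
    simp
  · rw [descentHom_some hb hx]
    exact intCast_zmod_two_eq_zero (even_padicValRat_of_not_dvd Fact.out h2 hx
      ((nonsingular_iff_eq _ _).mp h).1)

/-- The image of a `2`-isogeny contains the kernel of the descent map. -/
lemma ker_descentHom_le {c d u : ℚ} (D : IsogenyData c d a b u)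
    (hs : ∀ l : ℕ, l.Prime → (l : ℤ) ∣ b → l = 2 ∨ l = p) :
    (descentHom p hb : Pt (a : ℚ) (b : ℚ) →+ Parity).ker ≤ D.isogeny.range := by
  intro P hP
  rw [AddMonoidHom.mem_ker] at hP
  rcases P with _ | ⟨x, y, h⟩
  · exact zero_mem _
  have hl (l : ℕ) (hl : l.Prime) (h2 : l ≠ 2) (h3 : l ≠ p) : ¬ (l : ℤ) ∣ b := fun h ↦
    (hs l hl h).elim h2 h3
  by_cases hx : x = 0
  · rw [descentHom_some_zero hb hx] at hP
    obtain ⟨s, hs⟩ := isSquare_of_parity_eq_zero hb hP fun l h1 h2 h3 ↦ by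
      have : Fact l.Prime := ⟨h1⟩
      rw [padicValRat.of_int, padicValInt.eq_zero_of_not_dvd (hl l h1 h2 h3)]
      simp
    subst hx
    exact D.zero_mem_range_of_eq_sq h (hs.trans (sq s).symm)
  · rw [descentHom_some hb hx] at hP
    obtain ⟨s, hs⟩ := isSquare_of_parity_eq_zero hx hP fun l h1 h2 h3 ↦
      even_padicValRat_of_not_dvd h1 (hl l h1 h2 h3) hx ((nonsingular_iff_eq _ _).mp h).1
    exact D.mem_range_of_eq_sq h hx (hs.trans (sq s).symm)

lemma index_range_isogeny {c d u : ℚ} (D : IsogenyData c d a b u)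
    (hs : ∀ l : ℕ, l.Prime → (l : ℤ) ∣ b → l = 2 ∨ l = p) :
    D.isogeny.range.index ≠ 0 ∧ D.isogeny.range.index ≤
      Nat.card (descentHom p hb : Pt (a : ℚ) (b : ℚ) →+ Parity).range := by
  have h1 := AddSubgroup.index_dvd_of_le (ker_descentHom_le (p := p) hb D hs)
  rw [AddSubgroup.index_ker] at h1
  have h2 : 0 < Nat.card (descentHom p hb : Pt (a : ℚ) (b : ℚ) →+ Parity).range := Nat.card_pos
  exact ⟨fun h ↦ h2.ne' (Nat.eq_zero_of_zero_dvd (h ▸ h1)), Nat.le_of_dvd h2 h1⟩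

/-- If the class of `d` is in the image of the descent map and is neither trivial nor the class of
`b`, then the corresponding `2`-covering has a rational point. -/
lemma exists_cover_of_mem_range {d : ℤ} (hd : Squarefree d)
    (hs : ∀ l : ℕ, l.Prime → (l : ℤ) ∣ b → l = 2 ∨ l = p)
    (hsd : ∀ l : ℕ, l.Prime → (l : ℤ) ∣ d → l = 2 ∨ l = p)
    (h0 : parity p d ≠ 0) (h1 : parity p d ≠ parity p b)
    (hm : parity p d ∈ (descentHom p hb : Pt (a : ℚ) (b : ℚ) →+ Parity).range) :
    ∃ M e N : ℤ, IsCoprime M e ∧ d * N ^ 2 = d ^ 2 * M ^ 4 + a * d * M ^ 2 * e ^ 2 + b * e ^ 4 := by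
  obtain ⟨P, hP⟩ := hm
  rcases P with _ | ⟨x, y, h⟩
  · exact absurd hP.symm h0
  by_cases hx : x = 0
  · rw [descentHom_some_zero hb hx] at hP
    exact absurd hP.symm h1
  rw [descentHom_some hb hx] at hP
  have hd0 : (d : ℚ) ≠ 0 := by exact_mod_cast hd.ne_zero
  have q := ((nonsingular_iff_eq _ _).mp h).1
  -- As x has the class of d, it equals d t². Writing t = M/e and clearing denominators in the curve
  -- equation makes d K a square r²; squarefreeness of d gives d ∣ r, and N = r/d.
  obtain ⟨s, hs⟩ : IsSquare (x * d) := by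
    refine isSquare_of_parity_eq_zero (p := p) (mul_ne_zero hx hd0)
      (by rw [parity_mul hx hd0, hP, Parity.add_self]) fun l h1 h2 h3 ↦ ?_
    have : Fact l.Prime := ⟨h1⟩
    rw [padicValRat.mul hx hd0, padicValRat.of_int, padicValInt.eq_zero_of_not_dvd
      fun h ↦ (hsd l h1 h).elim h2 h3]
    simpa using even_padicValRat_of_not_dvd h1 (fun h ↦ (hs l h1 h).elim h2 h3) hx q
  obtain ⟨t, ht⟩ : ∃ t, t = s / d := ⟨_, rfl⟩
  have hxt : x = d * t ^ 2 := by
    rw [ht]; field_simp; linear_combination hs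
  have ht0 : t ≠ 0 := by rintro rfl; exact hx (by rw [hxt]; ring)
  have hden : (t.den : ℚ) ≠ 0 := by exact_mod_cast t.den_ne_zero
  have htq : t = t.num / t.den := (Rat.num_div_den t).symm
  obtain ⟨K, hK⟩ : ∃ K : ℤ, K = d ^ 2 * t.num ^ 4 + a * d * t.num ^ 2 * (t.den : ℤ) ^ 2 +
    b * (t.den : ℤ) ^ 4 := ⟨_, rfl⟩
  have hdK : ((d * K : ℤ) : ℚ) = (y / t * t.den ^ 2) ^ 2 := by
    have : (y / t * t.den ^ 2) ^ 2 = y ^ 2 / t ^ 2 * t.den ^ 4 := by ring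
    rw [this, q, hxt, hK]
    have hnum : (t.num : ℚ) = t * t.den := by rw [eq_comm]; exact Rat.mul_den_eq_num t
    push_cast
    rw [hnum]
    field_simp
  have hsq : IsSquare (d * K) := by
    rw [← Rat.isSquare_intCast_iff]
    exact ⟨_, hdK.trans (sq _)⟩
  obtain ⟨r, hr⟩ := hsq
  have hdr : d ∣ r := by
    have : d ∣ r ^ 2 := ⟨K, by rw [sq]; exact hr.symm⟩
    exact (hd.dvd_pow_iff_dvd two_ne_zero).mp this
  obtain ⟨N, rfl⟩ := hdr
  refine ⟨t.num, t.den, N, ?_, ?_⟩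
  · rw [Int.isCoprime_iff_gcd_eq_one]
    exact t.reduced
  · rw [← hK]
    apply mul_left_cancel₀ hd.ne_zero
    linear_combination -hr

end Valuation

end TwoTorsionCurve

/-! ### Counting descent images and bounding the rank. -/

namespace TwoTorsionCurve

/-- The subgroup of parities where the selected coordinates vanish. -/
def coordSubgroup (s t w : Bool) : AddSubgroup Parity where
  carrier := {v | (s = true → v.1 = 0) ∧ (t = true → v.2.1 = 0) ∧ (w = true → v.2.2 = 0)}
  zero_mem' := ⟨fun _ ↦ rfl, fun _ ↦ rfl, fun _ ↦ rfl⟩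
  add_mem' := fun {v v'} h h' ↦ ⟨fun e ↦ by simp [h.1 e, h'.1 e],
    fun e ↦ by simp [h.2.1 e, h'.2.1 e], fun e ↦ by simp [h.2.2 e, h'.2.2 e]⟩
  neg_mem' := fun {v} h ↦ ⟨fun e ↦ by simp [h.1 e],
    fun e ↦ by simp [h.2.1 e], fun e ↦ by simp [h.2.2 e]⟩

/-- The order of `coordSubgroup s t w`. -/
def coordCard (s t w : Bool) : ℕ := cond s 1 2 * cond t 1 2 * cond w 1 2

instance (s t w : Bool) : DecidablePred (· ∈ coordSubgroup s t w) := fun v ↦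
  inferInstanceAs (Decidable
    ((s = true → v.1 = 0) ∧ (t = true → v.2.1 = 0) ∧ (w = true → v.2.2 = 0)))

lemma card_coordSubgroup (s t w : Bool) : Nat.card (coordSubgroup s t w) = coordCard s t w := by
  rw [Nat.card_eq_fintype_card]
  revert s t w
  decide

variable {p : ℕ} [hp : Fact p.Prime]

lemma parity_two_pow_mul_pow (hp2 : p ≠ 2) (i j : ℕ) :
    parity p (2 ^ i * p ^ j) = (0, (i : ZMod 2), (j : ZMod 2)) := by
  have hp0 : (p : ℚ) ≠ 0 := by exact_mod_cast hp.out.ne_zero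
  have h1 : padicValRat p (2 : ℚ) = 0 := by
    have : ¬ p ∣ 2 := fun h ↦ hp2 ((Nat.prime_dvd_prime_iff_eq hp.out Nat.prime_two).mp h)
    exact_mod_cast congrArg (Nat.cast (R := ℤ)) (padicValNat.eq_zero_of_not_dvd this)
  have h2 : padicValRat 2 (p : ℚ) = 0 := by
    have : ¬ 2 ∣ p := fun h ↦ hp2 ((Nat.prime_dvd_prime_iff_eq Nat.prime_two hp.out).mp h).symm
    rw [padicValRat.of_nat, padicValNat.eq_zero_of_not_dvd this]; rfl
  have h3 : padicValRat 2 (2 : ℚ) = 1 := by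
    exact_mod_cast padicValRat.self (p := 2) (by norm_num)
  have h4 : padicValRat p (p : ℚ) = 1 := padicValRat.self hp.out.one_lt
  have hpos : ¬ ((2 : ℚ) ^ i * p ^ j < 0) := not_lt.mpr (by positivity)
  refine Prod.ext (if_neg hpos) (Prod.ext ?_ ?_)
  · simp only [parity]
    rw [padicValRat.mul (by positivity) (by positivity), padicValRat.pow,
      padicValRat.pow, h3, h2]
    simp
  · simp only [parity]
    rw [padicValRat.mul (by positivity) (by positivity), padicValRat.pow,
      padicValRat.pow, h1, h4]
    simp

lemma parity_neg_two_pow_mul_pow (hp2 : p ≠ 2) (i j : ℕ) :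
    parity p (-(2 ^ i * p ^ j)) = (1, (i : ZMod 2), (j : ZMod 2)) := by
  have hp0 : (p : ℚ) ≠ 0 := by exact_mod_cast hp.out.ne_zero
  have h1 : parity p (-1) = (1, 0, 0) := by
    simp [parity]
  rw [← neg_one_mul, parity_mul (by norm_num) (by positivity), h1, parity_two_pow_mul_pow hp2]
  simp

/-- `b` is nonzero and has no prime divisors other than `2` and `p`, and the image of the descent
map of `y² = x³ + a x² + b x` has at most `n` elements. -/
structure DescentBound (p : ℕ) [Fact p.Prime] (a b : ℤ) (n : ℕ) : Prop where
  ne_zero : (b : ℚ) ≠ 0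
  support : ∀ l : ℕ, l.Prime → (l : ℤ) ∣ b → l = 2 ∨ l = p
  card_le : Nat.card (descentHom p ne_zero : Pt (a : ℚ) (b : ℚ) →+ Parity).range ≤ n

section Bounds

variable {a b : ℤ}

lemma support_of_dvd {i j : ℕ} (h : b ∣ 2 ^ i * p ^ j) (l : ℕ) (hl : l.Prime)
    (hlb : (l : ℤ) ∣ b) : l = 2 ∨ l = p := by
  have h1 : l ∣ 2 ^ i * p ^ j := by exact_mod_cast hlb.trans h
  rcases hl.dvd_mul.mp h1 with h2 | h2
  · exact Or.inl ((Nat.prime_dvd_prime_iff_eq hl Nat.prime_two).mp (hl.dvd_of_dvd_pow h2))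
  · exact Or.inr ((Nat.prime_dvd_prime_iff_eq hl hp.out).mp (hl.dvd_of_dvd_pow h2))

lemma ne_zero_of_dvd {i j : ℕ} (h : b ∣ 2 ^ i * p ^ j) : (b : ℚ) ≠ 0 := by
  rintro h0
  rw [Int.cast_eq_zero] at h0
  subst h0
  have hp0 : (p : ℤ) ≠ 0 := by exact_mod_cast hp.out.ne_zero
  exact (mul_ne_zero (pow_ne_zero i two_ne_zero) (pow_ne_zero j hp0)) (zero_dvd_iff.mp h)

lemma range_descentHom_le (hb : (b : ℚ) ≠ 0) {s t w : Bool}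
    (hs : s = true → a ^ 2 - 4 * b < 0 ∨ 0 < b ∧ a < 0) (ht : t = true → ¬ 2 ∣ b)
    (hw : w = true → ¬ (p : ℤ) ∣ b) :
    (descentHom p hb : Pt (a : ℚ) (b : ℚ) →+ Parity).range ≤ coordSubgroup s t w := by
  rintro _ ⟨P, rfl⟩
  exact ⟨fun h ↦ descentHom_fst_eq_zero hb (hs h) P, fun h ↦ descentHom_snd_eq_zero hb (ht h) P,
    fun h ↦ descentHom_trd_eq_zero hb (hw h) P⟩

/-- The bound for the image of the descent map coming from signs and valuations. -/
lemma DescentBound.of_coord {i j : ℕ} (h : b ∣ 2 ^ i * p ^ j) (s t w : Bool)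
    (hs : s = true → a ^ 2 - 4 * b < 0 ∨ 0 < b ∧ a < 0) (ht : t = true → ¬ 2 ∣ b)
    (hw : w = true → ¬ (p : ℤ) ∣ b) : DescentBound p a b (coordCard s t w) := by
  refine ⟨ne_zero_of_dvd h, support_of_dvd h, ?_⟩
  rw [← card_coordSubgroup]
  exact AddSubgroup.card_le_of_le (range_descentHom_le _ hs ht hw)

/-- The bound for the image of the descent map when moreover the `2`-covering of some class `d` has
no rational point. -/
lemma DescentBound.of_not_cover {i j i' j' : ℕ} (h : b ∣ 2 ^ i * p ^ j) (s t w : Bool)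
    (hs : s = true → a ^ 2 - 4 * b < 0 ∨ 0 < b ∧ a < 0) (ht : t = true → ¬ 2 ∣ b)
    (hw : w = true → ¬ (p : ℤ) ∣ b) (d : ℤ) (hd : Squarefree d) (hd' : d ∣ 2 ^ i' * p ^ j')
    (h0 : parity p d ≠ 0) (h1 : parity p d ≠ parity p b) (hm : parity p d ∈ coordSubgroup s t w)
    (hcover : ∀ M e N : ℤ, IsCoprime M e →
      d * N ^ 2 ≠ d ^ 2 * M ^ 4 + a * d * M ^ 2 * e ^ 2 + b * e ^ 4) :
    DescentBound p a b (coordCard s t w / 2) := by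
  refine ⟨ne_zero_of_dvd h, support_of_dvd h, ?_⟩
  have hle := range_descentHom_le (p := p) (ne_zero_of_dvd h) hs ht hw
  have hn : parity p d ∉ (descentHom p (ne_zero_of_dvd h) : Pt (a : ℚ) (b : ℚ) →+ Parity).range :=
    fun hmem ↦ by
      obtain ⟨M, e, N, hMe, hN⟩ := exists_cover_of_mem_range _ hd (support_of_dvd h)
        (support_of_dvd hd') h0 h1 hmem
      exact hcover M e N hMe hN
  -- The image omits an element of the coordinate subgroup, so its index there is at least 2.
  rw [← card_coordSubgroup, Nat.le_div_iff_mul_le two_pos, ← AddSubgroup.relIndex_bot_left,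
    ← AddSubgroup.relIndex_bot_left, ← AddSubgroup.relIndex_mul_relIndex ⊥ _ _ bot_le hle]
  refine Nat.mul_le_mul_left _ ?_
  have h1 : (descentHom p (ne_zero_of_dvd h) : Pt (a : ℚ) (b : ℚ) →+ Parity).range.relIndex
      (coordSubgroup s t w) ≠ 1 := fun h ↦ hn (AddSubgroup.relIndex_eq_one.mp h hm)
  have h2 : (descentHom p (ne_zero_of_dvd h) : Pt (a : ℚ) (b : ℚ) →+ Parity).range.relIndex
      (coordSubgroup s t w) ≠ 0 := AddSubgroup.index_ne_zero_of_finite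
  omega

end Bounds

section Rank

variable {a b a' b' : ℤ}

lemma isogenyData (ha' : a' = -2 * a) (hb' : b' = a ^ 2 - 4 * b) (h : b ≠ 0) (h' : b' ≠ 0) :
    IsogenyData (a : ℚ) b a' b' 1 := by
  refine ⟨one_ne_zero, by exact_mod_cast h, ?_, ?_, ?_⟩
  · rw [hb'] at h'; exact_mod_cast h'
  · rw [ha']; push_cast; ring
  · rw [hb']; push_cast; ring

lemma isogenyData_dual (ha' : a' = -2 * a) (hb' : b' = a ^ 2 - 4 * b) (h : b ≠ 0) (h' : b' ≠ 0) :
    IsogenyData (a' : ℚ) b' a b (1 / 2) := by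
  refine ⟨by norm_num, by exact_mod_cast h', ?_, ?_, ?_⟩
  · have : a' ^ 2 - 4 * b' = 16 * b := by rw [ha', hb']; ring
    have h2 : a' ^ 2 - 4 * b' ≠ 0 := by rw [this]; exact mul_ne_zero (by norm_num) h
    exact_mod_cast h2
  · rw [ha']; push_cast; ring
  · rw [ha', hb']; push_cast; ring

/-- Isogenous curves have the same rank. -/
lemma rank_eq (ha' : a' = -2 * a) (hb' : b' = a ^ 2 - 4 * b) (h : b ≠ 0) (h' : b' ≠ 0) :
    Module.rank ℤ (Pt (a : ℚ) (b : ℚ)) = Module.rank ℤ (Pt (a' : ℚ) (b' : ℚ)) := by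
  have D := isogenyData ha' hb' h h'
  have D' := isogenyData_dual ha' hb' h h'
  exact le_antisymm
    (rank_le_of_comp_eq_two (D.isogeny_comp_isogeny D' (by norm_num)))
    (rank_le_of_comp_eq_two (D'.isogeny_comp_isogeny D (by norm_num)))

/-- The bound for the rank by descent via a `2`-isogeny. -/
lemma rank_le_of_descentBound (ha' : a' = -2 * a) (hb' : b' = a ^ 2 - 4 * b) (hsq : ¬ IsSquare b')
    {n n' m : ℕ} (hn : DescentBound p a b n) (hn' : DescentBound p a' b' n')
    (hm : n * n' ≤ 2 ^ (m + 2)) : Module.rank ℤ (Pt (a : ℚ) (b : ℚ)) ≤ m := by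
  have h : b ≠ 0 := by exact_mod_cast hn.ne_zero
  have h' : b' ≠ 0 := by exact_mod_cast hn'.ne_zero
  have D := isogenyData ha' hb' h h'
  have D' := isogenyData_dual ha' hb' h h'
  have hcomp := D.isogeny_comp_isogeny D' (by norm_num)
  obtain ⟨i0, i1⟩ := index_range_isogeny hn'.ne_zero D hn'.support
  obtain ⟨j0, j1⟩ := index_range_isogeny hn.ne_zero D' hn.support
  have := fg_of_finiteIndex D.b_ne_zero D.disc_ne_zero (finiteIndex_range_nsmul_two hcomp i0 j0)
  have hT : (twoTorsionCurve (a : ℚ) b).toAffine.Nonsingular 0 0 :=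
    nonsingular_of_eq D.b_ne_zero D.disc_ne_zero (by ring)
  have hT' : (twoTorsionCurve (a' : ℚ) b').toAffine.Nonsingular 0 0 :=
    nonsingular_of_eq D'.b_ne_zero D'.disc_ne_zero (by ring)
  refine rank_le_of_index_mul_le hcomp i0 j0 (t := .some 0 0 hT) (Point.some_ne_zero _) ?_
    (t' := .some 0 0 hT') (D'.isogeny_some_zero _ rfl) (fun hmem ↦ hsq ?_)
    (le_trans ?_ hm)
  · rw [two_nsmul]
    exact Point.add_of_Y_eq rfl (by rw [negY_eq, neg_zero])
  · have := D.isSquare_of_zero_mem_range hT' hmem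
    rw [← Rat.isSquare_intCast_iff, hb']
    exact_mod_cast this
  · rw [mul_comm n]
    exact Nat.mul_le_mul (i1.trans hn'.card_le) (j1.trans hn.card_le)

end Rank

end TwoTorsionCurve

/-! ### 2-coverings without rational points. -/

namespace TwoTorsionCurve

section Covers

lemma odd_of_isCoprime_of_even {M e : ℤ} (h : IsCoprime M e) (hM : Even M) : Odd e := by
  rw [← Int.not_even_iff_odd]
  intro he
  have := h.isUnit_of_dvd' hM.two_dvd he.two_dvd
  exact absurd (Int.isUnit_iff.mp this) (by norm_num)

lemma Odd.intCast_zmod_eight_sq {x : ℤ} (h : Odd x) : (x : ZMod 8) ^ 2 = 1 := by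
  obtain ⟨k, rfl⟩ := h
  push_cast
  exact (by decide : ∀ k : ZMod 8, (2 * k + 1) ^ 2 = 1) _

lemma Odd.intCast_zmod_four_sq {x : ℤ} (h : Odd x) : (x : ZMod 4) ^ 2 = 1 := by
  obtain ⟨k, rfl⟩ := h
  push_cast
  exact (by decide : ∀ k : ZMod 4, (2 * k + 1) ^ 2 = 1) _

/-- A solution has N even, hence M⁴ + cM²e² - e⁴ even; but for c odd and M, e coprime this form is
always odd. -/
lemma not_cover_two_of_odd {c M e N : ℤ} (hc : Odd c) (h : IsCoprime M e) :
    2 * N ^ 2 ≠ 2 ^ 2 * M ^ 4 + 2 * c * 2 * M ^ 2 * e ^ 2 + -4 * e ^ 4 := by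
  intro hN
  have hN1 : N ^ 2 = 2 * (M ^ 4 + c * M ^ 2 * e ^ 2 - e ^ 4) := by linarith
  have hNe : Even N := (Int.even_pow' two_ne_zero).mp (hN1 ▸ even_two_mul _)
  obtain ⟨n, rfl⟩ := hNe.two_dvd
  have hn : M ^ 4 + c * M ^ 2 * e ^ 2 - e ^ 4 = 2 * n ^ 2 := by linarith
  have hev : Even (M ^ 4 + c * M ^ 2 * e ^ 2 - e ^ 4) := hn ▸ even_two_mul _
  rcases Int.even_or_odd M with hM | hM
  · have he := odd_of_isCoprime_of_even h hM
    have hM4 : Even (M ^ 4) := hM.pow_of_ne_zero (by norm_num)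
    have hM2 : Even (c * M ^ 2 * e ^ 2) :=
      ((hM.pow_of_ne_zero two_ne_zero).mul_left c).mul_right _
    exact Int.not_even_iff_odd.mpr ((hM4.add hM2).sub_odd he.pow) hev
  · rcases Int.even_or_odd e with he | he
    · have he4 : Even (e ^ 4) := he.pow_of_ne_zero (by norm_num)
      have he2 : Even (c * M ^ 2 * e ^ 2) := (he.pow_of_ne_zero two_ne_zero).mul_left _
      exact Int.not_even_iff_odd.mpr ((hM.pow.add_even he2).sub_even he4) hev
    · have h2 : Odd (c * M ^ 2 * e ^ 2) := (hc.mul hM.pow).mul he.pow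
      exact Int.not_even_iff_odd.mpr ((hM.pow.add_odd h2).sub_odd he.pow) hev

/-- Whether M is odd, or even with a factor 4 removed from N² and the right side, the equation would
make -1 a square modulo 8. -/
lemma not_cover_neg_one_of_seven_mod_eight {q c M e N : ℤ} (hq : (q : ZMod 8) = 7) (hc : Odd c)
    (h : IsCoprime M e) :
    -1 * N ^ 2 ≠ (-1) ^ 2 * M ^ 4 + -2 * (2 * c) * -1 * M ^ 2 * e ^ 2 + -(4 * q) * e ^ 4 := by
  intro hN
  obtain ⟨k, rfl⟩ := hc
  rcases Int.even_or_odd M with hM | hM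
  · have he := odd_of_isCoprime_of_even h hM
    obtain ⟨m, rfl⟩ := hM.two_dvd
    have hNe : Even N := by
      refine (Int.even_pow' two_ne_zero).mp ⟨2 * q * e ^ 4 - 8 * m ^ 4 -
        8 * (2 * k + 1) * m ^ 2 * e ^ 2, by linarith⟩
    obtain ⟨n, rfl⟩ := hNe.two_dvd
    have hn : -n ^ 2 = 4 * m ^ 4 + 4 * (2 * k + 1) * m ^ 2 * e ^ 2 - q * (e ^ 2) ^ 2 := by linarith
    have := congrArg (Int.cast : ℤ → ZMod 8) hn
    push_cast at this
    rw [Odd.intCast_zmod_eight_sq he, hq] at this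
    exact (by decide : ∀ n m k : ZMod 8,
      -n ^ 2 ≠ 4 * m ^ 4 + 4 * (2 * k + 1) * m ^ 2 * 1 - 7 * 1 ^ 2) _ _ _ this
  · have hn : -N ^ 2 = (M ^ 2) ^ 2 + 4 * (2 * k + 1) * M ^ 2 * e ^ 2 - 4 * q * e ^ 4 := by linarith
    have := congrArg (Int.cast : ℤ → ZMod 8) hn
    push_cast at this
    rw [Odd.intCast_zmod_eight_sq hM, hq] at this
    exact (by decide : ∀ N e k : ZMod 8,
      -N ^ 2 ≠ 1 ^ 2 + 4 * (2 * k + 1) * 1 * e ^ 2 - 4 * 7 * e ^ 4) _ _ _ this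

/-- Completing the square gives N² + X² = p c e⁴ with X = M² - g e². As -1 is not a square modulo p,
p divides N and X; then p² divides the left side, so p ∣ e and hence p ∣ M. -/
lemma not_cover_neg_one_of_three_mod_four {p : ℕ} [hp : Fact p.Prime] (hp4 : p % 4 = 3)
    {g b c M e N : ℤ} (hg : g ^ 2 - b = p * c) (hc : ¬ (p : ℤ) ∣ c) (h : IsCoprime M e) :
    -1 * N ^ 2 ≠ (-1) ^ 2 * M ^ 4 + 2 * g * -1 * M ^ 2 * e ^ 2 + b * e ^ 4 := by
  intro hN
  have hp' : Prime (p : ℤ) := Nat.prime_iff_prime_int.mp hp.out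
  obtain ⟨X, hX⟩ : ∃ X, X = M ^ 2 - g * e ^ 2 := ⟨_, rfl⟩
  have key : N ^ 2 + X ^ 2 = p * c * e ^ 4 := by
    rw [hX, ← hg]; linear_combination -hN
  have hzero : (N : ZMod p) ^ 2 = -(X : ZMod p) ^ 2 := by
    have := congrArg (Int.cast : ℤ → ZMod p) key
    push_cast at this
    rw [CharP.cast_eq_zero, zero_mul, zero_mul] at this
    linear_combination this
  have hX0 : (X : ZMod p) = 0 := by
    by_contra h0
    exact ZMod.mod_four_ne_three_of_sq_eq_neg_sq' h0 hzero hp4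
  have hN0 : (N : ZMod p) = 0 := by simpa [hX0] using hzero
  obtain ⟨x, hx⟩ := (ZMod.intCast_zmod_eq_zero_iff_dvd X p).mp hX0
  obtain ⟨n, hn⟩ := (ZMod.intCast_zmod_eq_zero_iff_dvd N p).mp hN0
  have h1 : (p : ℤ) * (n ^ 2 + x ^ 2) = c * e ^ 4 := by
    apply mul_left_cancel₀ hp'.ne_zero
    rw [hx, hn] at key
    linear_combination key
  have he : (p : ℤ) ∣ e :=
    hp'.dvd_of_dvd_pow ((hp'.dvd_or_dvd (Dvd.intro _ h1)).resolve_left hc)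
  have hM : (p : ℤ) ∣ M := by
    refine hp'.dvd_of_dvd_pow (n := 2) ?_
    rw [show M ^ 2 = X + g * e * e by rw [hX]; ring, hx]
    exact dvd_add (dvd_mul_right _ _) (dvd_mul_of_dvd_right he _)
  exact hp'.not_isUnit (h.isUnit_of_dvd' hM he)

/-- Here N and M are forced to be even; dividing by 8 then leaves (N/2)² ≡ q e⁴ ≡ 3 modulo 4. -/
lemma not_cover_two_of_three_mod_four {q c M e N : ℤ} (hq : (q : ZMod 4) = 3)
    (h : IsCoprime M e) :
    2 * N ^ 2 ≠ 2 ^ 2 * M ^ 4 + -2 * (4 * c) * 2 * M ^ 2 * e ^ 2 + 8 * q * e ^ 4 := by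
  intro hN
  have hNe : Even N := (Int.even_pow' two_ne_zero).mp
    ⟨M ^ 4 - 4 * c * M ^ 2 * e ^ 2 + 2 * q * e ^ 4, by linarith⟩
  obtain ⟨n, rfl⟩ := hNe.two_dvd
  have hMe : Even M := (Int.even_pow' four_ne_zero).mp
    ⟨n ^ 2 + 2 * c * M ^ 2 * e ^ 2 - q * e ^ 4, by linarith⟩
  have he := odd_of_isCoprime_of_even h hMe
  obtain ⟨m, rfl⟩ := hMe.two_dvd
  have hn : n ^ 2 = 4 * (2 * m ^ 4 - 2 * c * m ^ 2 * e ^ 2) + q * (e ^ 2) ^ 2 := by linarith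
  have := congrArg (Int.cast : ℤ → ZMod 4) hn
  push_cast at this
  rw [Odd.intCast_zmod_four_sq he, hq, show (4 : ZMod 4) = 0 from rfl] at this
  rw [zero_mul] at this
  exact (by decide : ∀ n : ZMod 4, n ^ 2 ≠ 0 + 3 * 1 ^ 2) _ this

/-- For M odd, -1 would be a square modulo 8. For M even, repeated halving makes e even too, against
coprimality. -/
lemma not_cover_neg_one_of_neg_eight {c M e N : ℤ} (h : IsCoprime M e) :
    -1 * N ^ 2 ≠ (-1) ^ 2 * M ^ 4 + -2 * (4 * c) * -1 * M ^ 2 * e ^ 2 + -8 * e ^ 4 := by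
  intro hN
  rcases Int.even_or_odd M with hM | hM
  · have he := odd_of_isCoprime_of_even h hM
    obtain ⟨m, rfl⟩ := hM.two_dvd
    have hNe : Even N := (Int.even_pow' two_ne_zero).mp
      ⟨4 * e ^ 4 - 8 * m ^ 4 - 16 * c * m ^ 2 * e ^ 2, by linarith⟩
    obtain ⟨n, rfl⟩ := hNe.two_dvd
    have hne : Even n := (Int.even_pow' two_ne_zero).mp
      ⟨e ^ 4 - 2 * m ^ 4 - 4 * c * m ^ 2 * e ^ 2, by linarith⟩
    obtain ⟨r, rfl⟩ := hne.two_dvd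
    have hee : Even e := (Int.even_pow' four_ne_zero).mp
      ⟨r ^ 2 + m ^ 4 + 2 * c * m ^ 2 * e ^ 2, by linarith⟩
    exact Int.not_even_iff_odd.mpr he hee
  · have hn : -N ^ 2 = (M ^ 2) ^ 2 + 8 * (c * M ^ 2 * e ^ 2 - e ^ 4) := by linarith
    have := congrArg (Int.cast : ℤ → ZMod 8) hn
    push_cast at this
    rw [Odd.intCast_zmod_eight_sq hM, show (8 : ZMod 8) = 0 from rfl] at this
    rw [zero_mul] at this
    exact (by decide : ∀ n : ZMod 8, -n ^ 2 ≠ 1 ^ 2 + 0) _ this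

lemma not_cover_self_of_three_mod_four {q c M e N : ℤ} (hq0 : q ≠ 0) (hq : (q : ZMod 4) = 3)
    (hqo : Odd q) (h : IsCoprime M e) :
    q * N ^ 2 ≠ q ^ 2 * M ^ 4 + -2 * (4 * c) * q * M ^ 2 * e ^ 2 + 8 * q ^ 2 * e ^ 4 := by
  intro hN'
  have hN : N ^ 2 = q * M ^ 4 - 8 * c * M ^ 2 * e ^ 2 + 8 * q * e ^ 4 := by
    apply mul_left_cancel₀ hq0
    linear_combination hN'
  rcases Int.even_or_odd M with hM | hM
  · have he := odd_of_isCoprime_of_even h hM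
    obtain ⟨m, rfl⟩ := hM.two_dvd
    have hNe : Even N := (Int.even_pow' two_ne_zero).mp
      ⟨8 * q * m ^ 4 - 16 * c * m ^ 2 * e ^ 2 + 4 * q * e ^ 4, by linarith⟩
    obtain ⟨n, rfl⟩ := hNe.two_dvd
    have hne : Even n := (Int.even_pow' two_ne_zero).mp
      ⟨2 * q * m ^ 4 - 4 * c * m ^ 2 * e ^ 2 + q * e ^ 4, by linarith⟩
    obtain ⟨r, rfl⟩ := hne.two_dvd
    have hee : Even (q * e ^ 4) :=
      ⟨r ^ 2 - q * m ^ 4 + 2 * c * m ^ 2 * e ^ 2, by linarith⟩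
    exact Int.not_even_iff_odd.mpr (hqo.mul he.pow) hee
  · have hn : N ^ 2 = q * (M ^ 2) ^ 2 + 4 * (2 * q * e ^ 4 - 2 * c * M ^ 2 * e ^ 2) := by linarith
    have := congrArg (Int.cast : ℤ → ZMod 4) hn
    push_cast at this
    rw [Odd.intCast_zmod_four_sq hM, hq, show (4 : ZMod 4) = 0 from rfl] at this
    rw [zero_mul] at this
    exact (by decide : ∀ n : ZMod 4, n ^ 2 ≠ 3 * 1 ^ 2 + 0) _ this

end Covers

/-! ### Rank bounds by the shape of b and b'. -/

section Families

variable {p : ℕ} [hp : Fact p.Prime] {a b b' : ℤ}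

lemma parity_intCast (hp2 : p ≠ 2) {z : ℤ} (i j : ℕ) (hz : z = 2 ^ i * p ^ j) :
    parity p (z : ℚ) = (0, (i : ZMod 2), (j : ZMod 2)) := by
  rw [hz]; push_cast; exact parity_two_pow_mul_pow hp2 i j

lemma parity_intCast_neg (hp2 : p ≠ 2) {z : ℤ} (i j : ℕ) (hz : z = -(2 ^ i * p ^ j)) :
    parity p (z : ℚ) = (1, (i : ZMod 2), (j : ZMod 2)) := by
  rw [hz]; push_cast; exact parity_neg_two_pow_mul_pow hp2 i j

lemma not_isSquare_of_parity_ne_zero {z : ℤ} (hz : z ≠ 0) (h : parity p (z : ℚ) ≠ 0) :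
    ¬ IsSquare z := by
  rintro ⟨r, rfl⟩
  have hr : (r : ℚ) ≠ 0 := by rintro h0; exact hz (by rw [Int.cast_eq_zero.mp h0, zero_mul])
  exact h (by rw [Int.cast_mul, ← sq]; exact parity_sq hr)

lemma prime_not_dvd_two_pow (hp2 : p ≠ 2) (i : ℕ) : ¬ (p : ℤ) ∣ 2 ^ i := by
  intro h
  have h1 : p ∣ 2 ^ i := by exact_mod_cast h
  exact hp2 ((Nat.prime_dvd_prime_iff_eq hp.out Nat.prime_two).mp (hp.out.dvd_of_dvd_pow h1))

lemma two_not_dvd_prime_pow (hp2 : p ≠ 2) (j : ℕ) : ¬ (2 : ℤ) ∣ (p : ℤ) ^ j := by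
  intro h
  have h1 : 2 ∣ p ^ j := by exact_mod_cast h
  exact hp2 ((Nat.prime_dvd_prime_iff_eq Nat.prime_two hp.out).mp
    (Nat.prime_two.dvd_of_dvd_pow h1)).symm

lemma two_not_dvd_prime (hp2 : p ≠ 2) : ¬ (2 : ℤ) ∣ (p : ℤ) := by
  simpa using two_not_dvd_prime_pow hp2 1

/-- The bound for the rank by `2`-isogeny descent, with the condition that `(0, 0)` is not in the
image of the isogeny expressed by parities. -/
lemma rank_le_of_bounds (hb' : b' = a ^ 2 - 4 * b) (hpar : parity p (b' : ℚ) ≠ 0) {n n' m : ℕ}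
    (hn : DescentBound p a b n) (hn' : DescentBound p (-2 * a) b' n') (hm : n * n' ≤ 2 ^ (m + 2)) :
    Module.rank ℤ (Pt (a : ℚ) (b : ℚ)) ≤ m :=
  rank_le_of_descentBound rfl hb'
    (not_isSquare_of_parity_ne_zero (by exact_mod_cast hn'.ne_zero) hpar) hn hn' hm

/-- The count is 4 · 2: sign and 2 remain on E, and only p on E', where the sign is killed by (-2a)²
- 4b' = 16b < 0. -/
lemma rank_le_one_of_neg_two_pow (hp2 : p ≠ 2) (i : ℕ) (hb : b = -2 ^ i)
    (hd : (p : ℤ) = a ^ 2 - 4 * b) : Module.rank ℤ (Pt (a : ℚ) (b : ℚ)) ≤ (1 : ℕ) := by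
  refine rank_le_of_bounds (p := p) hd ?_
    (.of_coord (i := i) (j := 0) ?_ false false true ?_ ?_ ?_)
    (.of_coord (i := 0) (j := 1) ?_ true true false ?_ ?_ ?_) (by decide)
  · rw [parity_intCast hp2 0 1 (by ring)]; decide
  · rw [hb]; simp
  · simp
  · simp
  · intro _; rw [hb, dvd_neg]; exact prime_not_dvd_two_pow hp2 i
  · simp
  · intro _; left; rw [hd, hb]; have : (0 : ℤ) < 2 ^ i := by positivity
    linarith
  · intro _; exact two_not_dvd_prime hp2
  · simp

/-- Both b and b' are positive and exactly one of a, -2a is negative, so the sign drops out on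
exactly one of the two curves by this argument. Either way the count is 8. -/
lemma rank_le_one_of_two_pow (hp2 : p ≠ 2) (i : ℕ) (hb : b = 2 ^ i) (ha : a ≠ 0)
    (hd : (p : ℤ) = a ^ 2 - 4 * b) : Module.rank ℤ (Pt (a : ℚ) (b : ℚ)) ≤ (1 : ℕ) := by
  have hp0 : (0 : ℤ) < p := by exact_mod_cast hp.out.pos
  have hpar : parity p ((p : ℤ) : ℚ) ≠ 0 := by
    rw [parity_intCast hp2 0 1 (by ring)]; decide
  have hw : ¬ (p : ℤ) ∣ b := by rw [hb]; exact prime_not_dvd_two_pow hp2 i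
  have hdb : b ∣ 2 ^ i * (p : ℤ) ^ 0 := by rw [hb]; simp
  have hdp : (p : ℤ) ∣ 2 ^ 0 * (p : ℤ) ^ 1 := by simp
  have hb0 : 0 < b := by rw [hb]; positivity
  rcases ha.lt_or_gt with h | h
  · exact rank_le_of_bounds (p := p) hd hpar
      (.of_coord hdb true false true (fun _ ↦ .inr ⟨hb0, h⟩) (by simp) (fun _ ↦ hw))
      (.of_coord hdp false true false (by simp) (fun _ ↦ two_not_dvd_prime hp2) (by simp))
      (by decide)
  · exact rank_le_of_bounds (p := p) hd hpar
      (.of_coord hdb false false true (by simp) (by simp) (fun _ ↦ hw))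
      (.of_coord hdp true true false (fun _ ↦ .inr ⟨hp0, by linarith⟩)
        (fun _ ↦ two_not_dvd_prime hp2) (by simp))
      (by decide)

lemma rank_le_one_of_two_pow_neg (hp2 : p ≠ 2) (i : ℕ) (hb : b = 2 ^ i)
    (hd : -(p : ℤ) = a ^ 2 - 4 * b) : Module.rank ℤ (Pt (a : ℚ) (b : ℚ)) ≤ (1 : ℕ) := by
  have hp0 : (0 : ℤ) < p := by exact_mod_cast hp.out.pos
  refine rank_le_of_bounds (p := p) hd ?_
    (.of_coord (i := i) (j := 0) (by rw [hb]; simp) true false true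
      (fun _ ↦ .inl (by linarith)) (by simp) (fun _ ↦ ?_))
    (.of_coord (i := 0) (j := 1) (by simp) false true false (by simp) (fun _ ↦ ?_) (by simp))
    (by decide)
  · rw [parity_intCast_neg hp2 0 1 (by ring)]; decide
  · rw [hb]; exact prime_not_dvd_two_pow hp2 i
  · rw [dvd_neg]; exact two_not_dvd_prime hp2

lemma rank_le_one_of_neg_one (i j : ℕ) (hb : b = -1)
    (hpar : parity p (b' : ℚ) ≠ 0) (hb' : b' = 2 ^ i * p ^ j)
    (hd : b' = a ^ 2 - 4 * b) : Module.rank ℤ (Pt (a : ℚ) (b : ℚ)) ≤ (1 : ℕ) := by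
  refine rank_le_of_bounds (p := p) hd hpar
    (.of_coord (i := 0) (j := 0) (by simp [hb]) false true true (by simp)
      (fun _ ↦ ?_) (fun _ ↦ ?_))
    (.of_coord (i := i) (j := j) (by rw [hb']) true false false
      (fun _ ↦ .inl (by rw [hd, hb]; linarith)) (by simp) (by simp))
    (by decide)
  · rw [hb]; decide
  · rw [hb, dvd_neg]
    exact fun h ↦ (Nat.prime_iff_prime_int.mp hp.out).not_isUnit (isUnit_of_dvd_one h)

lemma rank_le_one_of_prime (hp2 : p ≠ 2) (i : ℕ) (hb : b = p)
    (hd : -2 ^ i = a ^ 2 - 4 * b) : Module.rank ℤ (Pt (a : ℚ) (b : ℚ)) ≤ (1 : ℕ) := by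
  have h2 : (0 : ℤ) < 2 ^ i := by positivity
  refine rank_le_of_bounds (p := p) hd ?_
    (.of_coord (i := 0) (j := 1) (by simp [hb]) true true false
      (fun _ ↦ .inl (by rw [← hd]; linarith)) (fun _ ↦ ?_) (by simp))
    (.of_coord (i := i) (j := 0) (by simp) false false true (by simp) (by simp) (fun _ ↦ ?_))
    (by decide)
  · rw [parity_intCast_neg hp2 i 0 (by ring)]
    -- The parity of i is unknown, so the sign alone shows that b' is not a square.
    exact fun h ↦ absurd (congrArg Prod.fst h) (show ¬ (1 : ZMod 2) = 0 by decide)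
  · rw [hb]; exact two_not_dvd_prime hp2
  · rw [dvd_neg]; exact prime_not_dvd_two_pow hp2 i

lemma rank_le_one_of_prime_pow (hp2 : p ≠ 2) (k : ℕ) (hb : b = p ^ k) (ha : a ≠ 0)
    (hd : 8 = a ^ 2 - 4 * b) : Module.rank ℤ (Pt (a : ℚ) (b : ℚ)) ≤ (1 : ℕ) := by
  have hp0 : (0 : ℤ) < p := by exact_mod_cast hp.out.pos
  have hpar : parity p ((8 : ℤ) : ℚ) ≠ 0 := by
    rw [parity_intCast hp2 3 0 (by norm_num)]; decide
  have ht : ¬ 2 ∣ b := by rw [hb]; exact two_not_dvd_prime_pow hp2 k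
  have hw : ¬ (p : ℤ) ∣ 8 := by simpa using prime_not_dvd_two_pow hp2 3
  have hdb : b ∣ 2 ^ 0 * (p : ℤ) ^ k := by rw [hb]; simp
  have hd8 : (8 : ℤ) ∣ 2 ^ 3 * (p : ℤ) ^ 0 := by norm_num
  have hb0 : 0 < b := by rw [hb]; positivity
  rcases ha.lt_or_gt with h | h
  · exact rank_le_of_bounds (p := p) hd hpar
      (.of_coord hdb true true false (fun _ ↦ .inr ⟨hb0, h⟩) (fun _ ↦ ht) (by simp))
      (.of_coord hd8 false false true (by simp) (by simp) (fun _ ↦ hw))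
      (by decide)
  · exact rank_le_of_bounds (p := p) hd hpar
      (.of_coord hdb false true false (by simp) (fun _ ↦ ht) (by simp))
      (.of_coord hd8 true false true (fun _ ↦ .inr ⟨by norm_num, by linarith⟩)
        (by simp) (fun _ ↦ hw))
      (by decide)

lemma squarefree_neg_one : Squarefree (-1 : ℤ) := (IsUnit.neg isUnit_one).squarefree

lemma rank_le_one_of_neg_four (hp2 : p ≠ 2) {c : ℤ} (hc : Odd c) (hb : b = -4) (ha : a = 2 * c)
    (hd : 4 * (p : ℤ) = a ^ 2 - 4 * b) : Module.rank ℤ (Pt (a : ℚ) (b : ℚ)) ≤ (1 : ℕ) := by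
  have hw : ¬ (p : ℤ) ∣ 4 := by simpa using prime_not_dvd_two_pow hp2 2
  have h2 := parity_intCast (p := p) hp2 (z := 2) 1 0 (by norm_num)
  refine rank_le_of_bounds (p := p) hd ?_
    (.of_not_cover (i := 2) (j := 0) (i' := 1) (j' := 0) (by simp [hb]) false false true (by simp)
      (by simp) (fun _ ↦ by rw [hb, dvd_neg]; exact hw) 2 Int.prime_two.squarefree (by simp)
      ?_ ?_ ?_ fun M e N h ↦ ?_)
    (.of_coord (i := 2) (j := 1) (by norm_num) true false false
      (fun _ ↦ .inl (by rw [hd, hb]; linarith)) (by simp) (by simp))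
    (by decide)
  · rw [parity_intCast hp2 2 1 (by ring)]; decide
  · rw [h2]; decide
  · rw [h2, hb, parity_intCast_neg hp2 2 0 (by norm_num)]; decide
  · rw [h2]; decide
  · rw [ha, hb]; exact not_cover_two_of_odd hc h

lemma rank_le_one_of_two_pow_of_seven_mod_eight (hp2 : p ≠ 2) {c : ℤ} (i : ℕ) (hc : Odd c)
    (hp8 : p % 8 = 7) (hb : b = 2 ^ i) (ha : a = 2 * c) (hd : -(4 * (p : ℤ)) = a ^ 2 - 4 * b) :
    Module.rank ℤ (Pt (a : ℚ) (b : ℚ)) ≤ (1 : ℕ) := by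
  have hp0 : (0 : ℤ) < p := by exact_mod_cast hp.out.pos
  have h1 := parity_intCast_neg (p := p) hp2 (z := -1) 0 0 (by norm_num)
  refine rank_le_of_bounds (p := p) hd ?_
    (.of_coord (i := i) (j := 0) (by rw [hb]; simp) true false true
      (fun _ ↦ .inl (by linarith)) (by simp)
      (fun _ ↦ by rw [hb]; exact prime_not_dvd_two_pow hp2 i))
    (.of_not_cover (i := 2) (j := 1) (i' := 0) (j' := 0) (by norm_num) false false false (by simp)
      (by simp) (by simp) (-1) squarefree_neg_one (by simp) ?_ ?_ ?_ fun M e N h ↦ ?_)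
    (by decide)
  · rw [parity_intCast_neg hp2 2 1 (by ring)]; decide
  · rw [h1]; decide
  · rw [h1, parity_intCast_neg hp2 2 1 (by ring)]; decide
  · rw [h1]; decide
  · rw [ha]
    refine not_cover_neg_one_of_seven_mod_eight ?_ hc h
    rw [Int.cast_natCast, ← ZMod.natCast_mod, hp8]; rfl

lemma descentBound_neg_two (hp2 : p ≠ 2) (hp4 : p % 4 = 3) {g c : ℤ} (hg : g ^ 2 + 2 = p * c)
    (hc : ¬ (p : ℤ) ∣ c) (hb : b = -2) (ha : a = 2 * g) : DescentBound p a b 2 := by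
  have h1 := parity_intCast_neg (p := p) hp2 (z := -1) 0 0 (by norm_num)
  have hw : ¬ (p : ℤ) ∣ 2 := by simpa using prime_not_dvd_two_pow hp2 1
  refine DescentBound.of_not_cover (i := 1) (j := 0) (i' := 0) (j' := 0) (by simp [hb])
    false false true (by simp) (by simp) (fun _ ↦ by rw [hb, dvd_neg]; exact hw)
    (-1) squarefree_neg_one (by simp) ?_ ?_ ?_ fun M e N h ↦ ?_
  · rw [h1]; decide
  · rw [h1, hb, parity_intCast_neg hp2 1 0 (by norm_num)]; decide
  · rw [h1]; decide
  · rw [ha, hb]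
    exact not_cover_neg_one_of_three_mod_four hp4 (by rw [← hg]; ring) hc h

lemma rank_le_one_of_neg_two (hp2 : p ≠ 2) (hp4 : p % 4 = 3) {g : ℤ} (hb : b = -2)
    (ha : a = 2 * g) (hd : 4 * (p : ℤ) = a ^ 2 - 4 * b) :
    Module.rank ℤ (Pt (a : ℚ) (b : ℚ)) ≤ (1 : ℕ) := by
  refine rank_le_of_bounds (p := p) hd ?_
    (descentBound_neg_two hp2 hp4 (g := g) (c := 1) ?_ ?_ hb ha)
    (.of_coord (i := 2) (j := 1) (by norm_num) true false false
      (fun _ ↦ .inl (by rw [hd, hb]; linarith)) (by simp) (by simp))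
    (by decide)
  · rw [parity_intCast hp2 2 1 (by ring)]; decide
  · rw [ha, hb] at hd; linarith
  · simpa using prime_not_dvd_two_pow hp2 0

/-- The class of 2 is excluded. The flag `s` records whether the sign is known to vanish, so the
bound is 2 or 4 and serves several families. -/
lemma descentBound_eight_mul_prime (hp2 : p ≠ 2) (hp4 : p % 4 = 3) {c : ℤ} (ha : a = 4 * c)
    (s : Bool) (hs : s = true →
      (-2 * a) ^ 2 - 4 * (8 * (p : ℤ)) < 0 ∨ 0 < 8 * (p : ℤ) ∧ -2 * a < 0) :
    DescentBound p (-2 * a) (8 * p) (coordCard s false false / 2) := by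
  have h2 := parity_intCast (p := p) hp2 (z := 2) 1 0 (by norm_num)
  refine .of_not_cover (i := 3) (j := 1) (i' := 1) (j' := 0) (by norm_num) s false false hs
      (by simp) (by simp) 2 Int.prime_two.squarefree (by simp) ?_ ?_ ?_ fun M e N h ↦ ?_
  · rw [h2]; decide
  · rw [h2, parity_intCast hp2 3 1 (by ring)]; decide
  · rw [h2]; cases s <;> decide
  · rw [ha]
    refine not_cover_two_of_three_mod_four ?_ h
    rw [Int.cast_natCast, ← ZMod.natCast_mod, hp4]; rfl

/-- A class is excluded on each curve, -1 on E and 2 on E'. The count 2 · 2 leaves no room for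
positive rank. -/
lemma rank_le_zero_of_neg_two (hp2 : p ≠ 2) (hp4 : p % 4 = 3) {c : ℤ} (hb : b = -2)
    (ha : a = 4 * c) (hd : 8 * (p : ℤ) = a ^ 2 - 4 * b) :
    Module.rank ℤ (Pt (a : ℚ) (b : ℚ)) ≤ (0 : ℕ) := by
  refine rank_le_of_bounds (p := p) hd ?_
    (descentBound_neg_two hp2 hp4 (g := 2 * c) (c := 2) ?_ ?_ hb (by rw [ha]; ring))
    (descentBound_eight_mul_prime hp2 hp4 ha true
      (fun _ ↦ .inl (by rw [hd, hb]; linarith)))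
    (by decide)
  · rw [parity_intCast hp2 3 1 (by ring)]; decide
  · rw [ha, hb] at hd; linarith
  · simpa using prime_not_dvd_two_pow hp2 1

lemma rank_le_one_of_two_mul_prime (hp2 : p ≠ 2) {c : ℤ} (hb : b = 2 * p) (ha : a = 4 * c)
    (hd : -8 = a ^ 2 - 4 * b) : Module.rank ℤ (Pt (a : ℚ) (b : ℚ)) ≤ (1 : ℕ) := by
  have h1 := parity_intCast_neg (p := p) hp2 (z := -1) 0 0 (by norm_num)
  have hw : ¬ (p : ℤ) ∣ 8 := by simpa using prime_not_dvd_two_pow hp2 3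
  refine rank_le_of_bounds (p := p) hd ?_
    (.of_coord (i := 1) (j := 1) (by simp [hb]) true false false
      (fun _ ↦ .inl (by rw [← hd]; norm_num)) (by simp) (by simp))
    (.of_not_cover (i := 3) (j := 0) (i' := 0) (j' := 0) (by norm_num) false false true (by simp)
      (by simp) (fun _ ↦ by rw [dvd_neg]; exact hw) (-1) squarefree_neg_one (by simp)
      ?_ ?_ ?_ fun M e N h ↦ ?_)
    (by decide)
  · rw [parity_intCast_neg hp2 3 0 (by norm_num)]; decide
  · rw [h1]; decide
  · rw [h1, parity_intCast_neg hp2 3 0 (by norm_num)]; decide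
  · rw [h1]; decide
  · rw [ha]
    exact not_cover_neg_one_of_neg_eight h

lemma descentBound_eight_mul_prime_sq (hp2 : p ≠ 2) (hp4 : p % 4 = 3) {c : ℤ} (ha : a = 4 * c)
    (s : Bool) (hs : s = true →
      (-2 * a) ^ 2 - 4 * (8 * (p : ℤ) ^ 2) < 0 ∨ 0 < 8 * (p : ℤ) ^ 2 ∧ -2 * a < 0) :
    DescentBound p (-2 * a) (8 * p ^ 2) (coordCard s false false / 2) := by
  have h2 := parity_intCast (p := p) hp2 (z := p) 0 1 (by ring)
  refine .of_not_cover (i := 3) (j := 2) (i' := 0) (j' := 1) (by norm_num) s false false hs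
      (by simp) (by simp) p (Nat.prime_iff_prime_int.mp hp.out).squarefree (by simp)
      ?_ ?_ ?_ fun M e N h ↦ ?_
  · rw [h2]; decide
  · rw [h2, parity_intCast hp2 3 2 (by ring)]; decide
  · rw [h2]; cases s <;> decide
  · rw [ha]
    refine not_cover_self_of_three_mod_four (by exact_mod_cast hp.out.ne_zero) ?_ ?_ h
    · rw [Int.cast_natCast, ← ZMod.natCast_mod, hp4]; rfl
    · exact_mod_cast hp.out.odd_of_ne_two hp2

/-- On E' the excluded class is 2 for k = 1 and p for k = 2. The sign of a decides which curve loses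
its sign coordinate; the count is 2 · 4 or 4 · 2. -/
lemma rank_le_one_of_two (hp2 : p ≠ 2) (hp4 : p % 4 = 3) {c : ℤ} {k : ℕ} (hk : k = 1 ∨ k = 2)
    (hb : b = 2) (ha : a = 4 * c) (ha0 : a ≠ 0) (hd : 8 * (p : ℤ) ^ k = a ^ 2 - 4 * b) :
    Module.rank ℤ (Pt (a : ℚ) (b : ℚ)) ≤ (1 : ℕ) := by
  have hp0 : (0 : ℤ) < p := by exact_mod_cast hp.out.pos
  have hw : ¬ (p : ℤ) ∣ b := by rw [hb]; simpa using prime_not_dvd_two_pow hp2 1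
  have hdb : b ∣ 2 ^ 1 * (p : ℤ) ^ 0 := by simp [hb]
  have hpar : parity p ((8 * (p : ℤ) ^ k : ℤ) : ℚ) ≠ 0 := by
    rw [parity_intCast hp2 3 k (by norm_num)]
    exact fun h ↦ absurd (congrArg (fun v : Parity ↦ v.2.1) h)
      (show ¬ ((3 : ℕ) : ZMod 2) = 0 by decide)
  have hE' (s : Bool) (hs : s = true → 0 < a) :
      DescentBound p (-2 * a) (8 * p ^ k) (coordCard s false false / 2) := by
    rcases hk with rfl | rfl
    · rw [pow_one]
      exact descentBound_eight_mul_prime hp2 hp4 ha s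
        fun h ↦ .inr ⟨by positivity, by linarith [hs h]⟩
    · exact descentBound_eight_mul_prime_sq hp2 hp4 ha s
        fun h ↦ .inr ⟨by positivity, by linarith [hs h]⟩
  rcases ha0.lt_or_gt with h | h
  · exact rank_le_of_bounds (p := p) hd hpar
      (.of_coord hdb true false true (fun _ ↦ .inr ⟨by rw [hb]; norm_num, h⟩) (by simp)
        (fun _ ↦ hw))
      (hE' false (by simp)) (by decide)
  · exact rank_le_of_bounds (p := p) hd hpar
      (.of_coord hdb false false true (by simp) (by simp) (fun _ ↦ hw))
      (hE' true (fun _ ↦ h)) (by decide)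

end Families

end TwoTorsionCurve

/-! ### Application to the Ivorra families. -/

open TwoTorsionCurve

/-- The coefficient `a² - 4 b` of the isogenous curve. -/
def IvorraType.disc (p k : ℕ) : IvorraType → ℤ
  | I | II | III | IV => p
  | V => -p
  | VI | VIII | IX | XVI => 4 * p
  | VII | XII => -4
  | X => -(4 * p)
  | XI | XVII | XIX => 8 * p ^ k
  | XIII | XX => 8
  | XIV => 4 * p ^ k
  | XV | XVIII => -8

namespace IsIvorraPair

variable {T : IvorraType} {p k : ℕ} {a b : ℤ}

lemma ne_two (h : IsIvorraPair T p k a b) : p ≠ 2 := by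
  have := h.le_p
  omega

lemma odd_p (h : IsIvorraPair T p k a b) : Odd (p : ℤ) := by
  exact_mod_cast h.prime.odd_of_ne_two h.ne_two

lemma two_mul_pow_sub_one_div (h : IsIvorraPair T p k a b) :
    2 * (((p : ℤ) ^ k - 1) / 2) = p ^ k - 1 := by
  obtain ⟨m, hm⟩ := h.odd_p.pow (n := k)
  omega

lemma two_mul_pow_add_one_div (h : IsIvorraPair T p k a b) :
    2 * (((p : ℤ) ^ k + 1) / 2) = p ^ k + 1 := by
  obtain ⟨m, hm⟩ := h.odd_p.pow (n := k)
  omega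

/-- Inserting α² = β cancels all but one term, up to sign a product of powers of 2 and p. This is
why two primes suffice in the descent on E'. -/
lemma disc_eq (h : IsIvorraPair T p k a b) : T.disc p k = a ^ 2 - 4 * b := by
  have hsub := h.two_mul_pow_sub_one_div
  have hadd := h.two_mul_pow_add_one_div
  obtain ⟨_, _, hk, ⟨α, ⟨hα, _, _⟩, ha⟩, hb⟩ := h
  have hpow (hk2 : 2 ≤ k) : 4 * (2 : ℤ) ^ (k - 2) = 2 ^ k := by
    obtain ⟨j, rfl⟩ := Nat.exists_eq_add_of_le hk2
    rw [Nat.add_sub_cancel_left, pow_add]; norm_num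
  cases T <;> simp only [IvorraType.AdmissibleK, IvorraType.beta, IvorraType.AdmissibleA,
    IvorraType.coeffB, IvorraType.disc] at *
  case I | III =>
    have ha2 : a ^ 2 = α ^ 2 := by first | rw [ha]; ring | rcases ha with rfl | rfl <;> ring
    linear_combination -ha2 - hα + 4 * hb - hpow (by omega)
  case II | IV =>
    have ha2 : a ^ 2 = α ^ 2 := by first | rw [ha]; ring | rcases ha with rfl | rfl <;> ring
    linear_combination -ha2 - hα + 4 * hb + hpow (by omega)
  case V =>
    have ha2 : a ^ 2 = α ^ 2 := by rw [ha]; ring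
    linear_combination -ha2 - hα + 4 * hb + hpow (by omega)
  case XVII | XVIII =>
    have ha2 : a ^ 2 = 16 * α ^ 2 := by rcases ha with rfl | rfl <;> ring
    linear_combination -ha2 - 16 * hα + 4 * hb - 8 * hsub
  case XIX | XX =>
    have ha2 : a ^ 2 = 16 * α ^ 2 := by rcases ha with rfl | rfl <;> ring
    linear_combination -ha2 - 16 * hα + 4 * hb - 8 * hadd
  all_goals
    have ha2 : a ^ 2 = 4 * α ^ 2 := by rcases ha with rfl | rfl <;> ring
    linear_combination -ha2 - 4 * hα + 4 * hb

lemma b_ne_zero (h : IsIvorraPair T p k a b) : b ≠ 0 := by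
  have hp := h.prime.ne_zero
  rw [h.coeffB_eq]
  cases T <;> simp [IvorraType.coeffB, hp]

lemma disc_ne_zero (h : IsIvorraPair T p k a b) : T.disc p k ≠ 0 := by
  have hp := h.prime.ne_zero
  cases T <;> simp [IvorraType.disc, hp]

/-- The two curves of an Ivorra pair have the same rank. -/
lemma mordellWeilRank_eq (h : IsIvorraPair T p k a b) :
    mordellWeilRank (ivorraCurve a b) = mordellWeilRank (ivorraCurve' a b) :=
  rank_eq rfl rfl h.b_ne_zero (h.disc_eq ▸ h.disc_ne_zero)

/-- In family XII with `k = 2` the prime `p` is `1` modulo `4`, so `-64 = (2 (1 + i))⁴` is a fourth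
power modulo `p`. -/
lemma exists_pow_four_eq (h : IsIvorraPair .XII p 2 a b) : ∃ x : ZMod p, x ^ 4 = -64 := by
  obtain ⟨_, _, _, ⟨α, ⟨hα, _, _⟩, _⟩, _⟩ := h
  have h1 : (α : ZMod p) ^ 2 = -1 := by
    have := congrArg (Int.cast : ℤ → ZMod p) hα
    simpa [IvorraType.beta] using this
  refine ⟨2 * (1 + α), ?_⟩
  linear_combination (16 * (α : ZMod p) ^ 2 + 64 * α + 80) * h1

lemma emod_four_of_XVI (h : IsIvorraPair .XVI p k a b) : p % 4 = 3 := by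
  have hodd := h.odd_p
  obtain ⟨_, _, _, ⟨α, ⟨hα, _, _⟩, _⟩, _⟩ := h
  have hα : α ^ 2 = p - 2 := hα
  have h2 : Odd α := by
    rw [← Int.odd_pow' two_ne_zero, hα]
    exact hodd.sub_even even_two
  have := Int.sq_mod_four_eq_one_of_odd h2
  omega

/-- The value k = 2 would give α² = 4 - p < 0. For k ≥ 3, α is odd and p = 2ᵏ - α² ≡ -1 modulo 8. -/
lemma emod_eight_of_X (h : IsIvorraPair .X p k a b) : p % 8 = 7 := by
  have hodd := h.odd_p
  obtain ⟨_, hle, ⟨hk, _⟩, ⟨α, ⟨hα, _, _⟩, _⟩, _⟩ := h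
  have hα : α ^ 2 = 2 ^ k - p := hα
  have hk3 : 3 ≤ k := by
    by_contra! hlt
    obtain rfl : k = 2 := by omega
    have : (29 : ℤ) ≤ p := by exact_mod_cast hle
    nlinarith [sq_nonneg α]
  obtain ⟨j, rfl⟩ := Nat.exists_eq_add_of_le hk3
  have h8 : (2 : ℤ) ^ (3 + j) = 8 * 2 ^ j := by rw [pow_add]; norm_num
  rw [h8] at hα
  have h2 : Odd α := by
    rw [← Int.odd_pow' two_ne_zero, hα]
    exact Even.sub_odd ⟨4 * 2 ^ j, by ring⟩ hodd
  obtain ⟨t, rfl⟩ := h2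
  obtain ⟨r, hr⟩ := Int.even_mul_succ_self t
  have : (2 * t + 1) ^ 2 = 8 * r + 1 := by linear_combination 4 * hr
  omega

/-- In both cases p ≡ ±1 modulo 8: for k = 1 because p = 2α² - 1, for k = 2 because 2α² ≡ 1 modulo p
makes 2 a square modulo p. -/
lemma emod_four_of_XIX (h : IsIvorraPair .XIX p k a b) (hp : ¬ p ≡ 1 [MOD 8]) : p % 4 = 3 := by
  have hadd := h.two_mul_pow_add_one_div
  have hp2 := h.ne_two
  obtain ⟨hprime, _, hk, ⟨α, ⟨hα, _, _⟩, _⟩, _⟩ := h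
  have hα : α ^ 2 = (p ^ k + 1) / 2 := hα
  rw [← hα] at hadd
  have hp1 : p % 8 ≠ 1 := hp
  rcases hk with rfl | rfl
  · rw [pow_one] at hadd
    rcases Int.even_or_odd' α with ⟨t, rfl | rfl⟩
    · have : (2 * t) ^ 2 = 4 * t ^ 2 := by ring
      omega
    · obtain ⟨r, hr⟩ := Int.even_mul_succ_self t
      have : (2 * t + 1) ^ 2 = 8 * r + 1 := by linear_combination 4 * hr
      omega
  · have : Fact p.Prime := ⟨hprime⟩
    have h1 : (2 : ZMod p) * α ^ 2 = 1 := by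
      have := congrArg (Int.cast : ℤ → ZMod p) hadd
      simpa using this
    have h2 : IsSquare (2 : ZMod p) := ⟨2 * α, by linear_combination -2 * h1⟩
    have := (ZMod.exists_sq_eq_two_iff hp2).mp h2
    omega

lemma a_ne_zero (h : IsIvorraPair T p k a b) (h0 : T.disc p k + 4 * b ≠ 0) : a ≠ 0 := by
  rintro rfl
  exact h0 (by rw [h.disc_eq]; ring)

lemma exists_eq_four_mul {α : ℤ} (ha : a = 4 * α ∨ a = -(4 * α)) : ∃ c, a = 4 * c := by
  rcases ha with rfl | rfl
  · exact ⟨α, rfl⟩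
  · exact ⟨-α, by ring⟩

lemma exists_eq_two_mul {α : ℤ} (ha : a = 2 * α ∨ a = -(2 * α)) :
    ∃ c, a = 2 * c ∧ c ^ 2 = α ^ 2 := by
  rcases ha with rfl | rfl
  · exact ⟨α, rfl, rfl⟩
  · exact ⟨-α, by ring, by ring⟩

lemma rank_le_zero_of_XVII (h : IsIvorraPair .XVII p 1 a b) (hp : p ≡ 3 [MOD 8]) :
    Module.rank ℤ (Pt (a : ℚ) (b : ℚ)) ≤ (0 : ℕ) := by
  have : Fact p.Prime := ⟨h.prime⟩
  have hd := h.disc_eq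
  obtain ⟨α, _, ha⟩ := h.admissibleA
  obtain ⟨c, hc⟩ := exists_eq_four_mul ha
  have hp8 : p % 8 = 3 := hp
  exact rank_le_zero_of_neg_two h.ne_two (by omega) h.coeffB_eq hc
    (by simpa [IvorraType.disc] using hd)

open IvorraType in
lemma rank_le_one (h : IsIvorraPair T p k a b)
    (hT : (T = I ∨ T = II ∨ T = III ∨ T = IV ∨ T = V ∨ T = VI ∨ T = VII ∨
          T = XI ∨ T = XIII ∨ T = XV) ∨
        (T = VIII ∧ k = 2) ∨
        T = X ∨
        (T = XII ∧ k = 2 ∧ ¬ ∃ x : ZMod p, x ^ 4 = -64) ∨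
        T = XVI ∨
        (T = XVII ∧ k = 1 ∧ p ≡ 3 [MOD 8]) ∨
        (T = XVIII ∧ k = 1) ∨
        (T = XIX ∧ ¬ p ≡ 1 [MOD 8])) :
    Module.rank ℤ (Pt (a : ℚ) (b : ℚ)) ≤ (1 : ℕ) := by
  have : Fact p.Prime := ⟨h.prime⟩
  have hp2 := h.ne_two
  have hp0 : (0 : ℤ) < p := by exact_mod_cast h.prime.pos
  have hd := h.disc_eq
  have hb := h.coeffB_eq
  have hodd := h.odd_p
  obtain ⟨α, ⟨hα, _, _⟩, ha⟩ := h.admissibleA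
  rcases hT with (rfl | rfl | rfl | rfl | rfl | rfl | rfl | rfl | rfl | rfl) | ⟨rfl, rfl⟩ | rfl |
    ⟨rfl, rfl, hx⟩ | rfl | ⟨rfl, rfl, hp⟩ | ⟨rfl, rfl⟩ | ⟨rfl, hp⟩
  · exact rank_le_one_of_neg_two_pow hp2 (k - 2) hb hd
  · refine rank_le_one_of_two_pow hp2 (k - 2) hb (h.a_ne_zero ?_) hd
    rw [hb]
    exact (show (0 : ℤ) < p + 4 * 2 ^ (k - 2) by positivity).ne'
  · exact rank_le_one_of_neg_two_pow hp2 (k - 2) hb hd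
  · refine rank_le_one_of_two_pow hp2 (k - 2) hb (h.a_ne_zero ?_) hd
    rw [hb]
    exact (show (0 : ℤ) < p + 4 * 2 ^ (k - 2) by positivity).ne'
  · exact rank_le_one_of_two_pow_neg hp2 (k - 2) hb hd
  · refine rank_le_one_of_neg_one (p := p) 2 1 hb ?_ (by norm_num [IvorraType.disc]) hd
    rw [parity_intCast hp2 2 1 (by norm_num [IvorraType.disc])]; decide
  · exact rank_le_one_of_prime hp2 2 hb (by simpa [IvorraType.disc] using hd)
  · refine rank_le_one_of_neg_one (p := p) 3 k hb ?_ (by norm_num [IvorraType.disc]) hd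
    rw [parity_intCast hp2 3 k (by norm_num [IvorraType.disc])]
    exact fun h ↦ absurd (congrArg (fun v : Parity ↦ v.2.1) h)
      (show ¬ ((3 : ℕ) : ZMod 2) = 0 by decide)
  · refine rank_le_one_of_prime_pow hp2 k hb (h.a_ne_zero ?_) hd
    rw [hb]
    exact (show (0 : ℤ) < 8 + 4 * p ^ k by positivity).ne'
  · exact rank_le_one_of_prime hp2 3 hb (by simpa [IvorraType.disc] using hd)
  · obtain ⟨c, hc, hc2⟩ := exists_eq_two_mul ha
    refine rank_le_one_of_neg_four hp2 (c := c) ?_ hb hc hd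
    rw [← Int.odd_pow' two_ne_zero, hc2, hα]
    exact hodd.sub_even (by decide)
  · obtain ⟨c, hc, hc2⟩ := exists_eq_two_mul ha
    refine rank_le_one_of_two_pow_of_seven_mod_eight hp2 (c := c) k ?_ h.emod_eight_of_X hb hc hd
    rw [← Int.odd_pow' two_ne_zero, hc2, hα]
    have hk : k ≠ 0 := by have := h.admissibleK.1; omega
    exact (even_two.pow_of_ne_zero hk).sub_odd hodd
  -- The hypothesis on -64 is contradictory here, so nothing remains to be bounded.
  · exact absurd h.exists_pow_four_eq hx
  · obtain ⟨c, hc, _⟩ := exists_eq_two_mul ha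
    exact rank_le_one_of_neg_two hp2 h.emod_four_of_XVI hb hc hd
  · exact (h.rank_le_zero_of_XVII hp).trans (by simp)
  · obtain ⟨c, hc⟩ := exists_eq_four_mul ha
    exact rank_le_one_of_two_mul_prime hp2 (by simpa [IvorraType.coeffB] using hb) hc hd
  · obtain ⟨c, hc⟩ := exists_eq_four_mul ha
    refine rank_le_one_of_two hp2 (h.emod_four_of_XIX hp) h.admissibleK hb hc (h.a_ne_zero ?_) hd
    rw [hb]
    exact (show (0 : ℤ) < 8 * p ^ k + 4 * 2 by positivity).ne'

end IsIvorraPair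

open IvorraType in
theorem theorem3p2 (T : IvorraType) (p k : ℕ) (a b : ℤ) (h : IsIvorraPair T p k a b) :
    mordellWeilRank (ivorraCurve a b) = mordellWeilRank (ivorraCurve' a b) ∧
    ((T = I ∨ T = II ∨ T = III ∨ T = IV ∨ T = V ∨ T = VI ∨ T = VII ∨
          T = XI ∨ T = XIII ∨ T = XV) ∨
        (T = VIII ∧ k = 2) ∨
        T = X ∨
        (T = XII ∧ k = 2 ∧ ¬ ∃ x : ZMod p, x ^ 4 = -64) ∨
        T = XVI ∨
        (T = XVII ∧ k = 1 ∧ p ≡ 3 [MOD 8]) ∨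
        (T = XVIII ∧ k = 1) ∨
        (T = XIX ∧ ¬ p ≡ 1 [MOD 8]) →
      mordellWeilRank (ivorraCurve a b) ≤ 1 ∧ mordellWeilRank (ivorraCurve' a b) ≤ 1) ∧
    (T = XVII ∧ k = 1 ∧ p ≡ 3 [MOD 8] →
      mordellWeilRank (ivorraCurve a b) = 0 ∧ mordellWeilRank (ivorraCurve' a b) = 0) := by
  rw [← h.mordellWeilRank_eq]
  refine ⟨rfl, fun hT ↦ ?_, ?_⟩
  · have hr : mordellWeilRank (ivorraCurve a b) ≤ (1 : ℕ) := h.rank_le_one hT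
    rw [Nat.cast_one] at hr
    exact ⟨hr, hr⟩
  · rintro ⟨rfl, rfl, hp⟩
    have hr : mordellWeilRank (ivorraCurve a b) ≤ (0 : ℕ) := h.rank_le_zero_of_XVII hp
    rw [Nat.cast_zero] at hr
    exact ⟨le_antisymm hr zero_le, le_antisymm hr zero_le⟩
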